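/- Let $n,m_1,m_2,T\ge 0$ be integers with $\frac T2>m_1+m_2$. For a prime power $q$ consider the two-source non-coherent matrix multiple access channel over $\mathbb{F}_q$: a discrete memoryless channel with inputs $X_i\in\mathbb{F}_q^{m_i\times T}$ ($i=1,2$) and output $$Y=G_1X_1+G_2X_2\in\mathbb{F}_q^{n\times T},$$ where in each channel use $G_1\in\mathbb{F}_q^{n\times m_1}$ and $G_2\in\mathbb{F}_q^{n\times m_2}$ are independent, uniformly distributed, independent of the inputs and of the other channel uses, and unknown to the sources and to the receiver. Let $\mathcal{C}_q\subseteq[0,\infty)^2$ be its capacity region, i.e. the closure of the set of pairs of rates (in bits per channel use) $(R_1,R_2)$ that the two sources, encoding independent uniformly distributed messages separately, can achieve with average error probability tending to $0$ as the block length tends to infinity. Put $$\mathcal{R}^*_q=\operatorname{conv}\bigcup_{(d_1,d_2)\in\mathcal{D}^*}\Big\{(R_1,R_2):\ 0\le R_i\le d_i(T-d_1-d_2)\log_2 q,\ i=1,2\Big\},$$ $$\mathcal{D}^*=\Big\{(d_1,d_2)\in\mathbb{Z}^2:\ 0\le d_i\le\min[n,m_i]\ (i=1,2),\ \ 0\le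 d_1+d_2\le\min[n,m_1+m_2]\Big\}.$$ Then $\mathcal{R}^*_q$ is the capacity region asymptotically in the field size: for fixed $n,m_1,m_2,T$ and every $\varepsilon\in(0,1)$ there is $q_0$ such that, for all prime powers $q\ge q_0$, $$(1-\varepsilon)\,\mathcal{R}^*_q\ \subseteq\ \mathcal{C}_q\ \subseteq\ (1+\varepsilon)\,\mathcal{R}^*_q .$$ -/

import Mathlib

open scoped Pointwise

noncomputable section

/-! ### Discrete memoryless two-user multiple access channels

A channel with input alphabets `A`, `B` and output alphabet `C` is a family of output laws
`W a b : PMF C`.  Its capacity region is the operational one: the closure of the set of achievable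
rate pairs, in bits per channel use. -/

section MAC

variable {A B C : Type*}

/-- A block code of length `N` with `M₁` and `M₂` messages for the two users: the encoders work
separately, the decoder estimates both messages from the `N` channel outputs. -/
structure MACCode (A B C : Type*) (N M₁ M₂ : ℕ) where
  enc₁ : Fin M₁ → Fin N → A
  enc₂ : Fin M₂ → Fin N → B
  dec : (Fin N → C) → Fin M₁ × Fin M₂

/-- Probability of receiving `y` when `a`, `b` are sent over `N` independent uses of `W`. -/
def blockProb (W : A → B → PMF C) {N : ℕ} (a : Fin N → A) (b : Fin N → B) (y : Fin N → C) : ℝ :=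
  ∏ t, (W (a t) (b t) (y t)).toReal

/-- Average probability of a decoding error, for independent uniformly distributed messages. -/
def MACCode.errorProb [Fintype C] (W : A → B → PMF C) {N M₁ M₂ : ℕ}
    (c : MACCode A B C N M₁ M₂) : ℝ :=
  (∑ w : Fin M₁ × Fin M₂, ∑ y : Fin N → C,
    if c.dec y = w then 0 else blockProb W (c.enc₁ w.1) (c.enc₂ w.2) y) / ((M₁ : ℝ) * M₂)

/-- A pair `R` of nonnegative rates is achievable if, for all large block lengths `N`, there are
codes with at least `2 ^ (N * R₁)` and `2 ^ (N * R₂)` messages and arbitrarily small average error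
probability. -/
def IsAchievable [Fintype C] (W : A → B → PMF C) (R : ℝ × ℝ) : Prop :=
  0 ≤ R.1 ∧ 0 ≤ R.2 ∧
    ∀ δ : ℝ, 0 < δ → ∃ N₀ : ℕ, ∀ N : ℕ, N₀ ≤ N →
      ∃ (M₁ M₂ : ℕ) (c : MACCode A B C N M₁ M₂),
        (2 : ℝ) ^ ((N : ℝ) * R.1) ≤ M₁ ∧ (2 : ℝ) ^ ((N : ℝ) * R.2) ≤ M₂ ∧ c.errorProb W ≤ δ

/-- The capacity region of the multiple access channel `W`. -/
def capacityRegion [Fintype C] (W : A → B → PMF C) : Set (ℝ × ℝ) :=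
  closure {R | IsAchievable W R}

end MAC

/-! ### The non-coherent matrix multiple access channel -/

/-- The channel `Y = G₁ X₁ + G₂ X₂`, with `(G₁, G₂)` uniform over all pairs of matrices of sizes
`n × m₁` and `n × m₂` (equivalently, all entries i.i.d. uniform over `F`), drawn afresh at each use
and unknown to the sources and to the receiver. -/
def matrixMAC (F : Type*) [Field F] [Fintype F] [DecidableEq F] (n m₁ m₂ T : ℕ)
    (X₁ : Matrix (Fin m₁) (Fin T) F) (X₂ : Matrix (Fin m₂) (Fin T) F) :
    PMF (Matrix (Fin n) (Fin T) F) :=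
  (PMF.uniformOfFintype (Matrix (Fin n) (Fin m₁) F × Matrix (Fin n) (Fin m₂) F)).map
    fun G => G.1 * X₁ + G.2 * X₂

/-- The admissible pairs of dimensions. -/
def dimPairs (n m₁ m₂ : ℕ) : Set (ℕ × ℕ) :=
  {d | d.1 ≤ min n m₁ ∧ d.2 ≤ min n m₂ ∧ d.1 + d.2 ≤ min n (m₁ + m₂)}

/-- The rectangle of rate pairs with `0 ≤ Rᵢ ≤ dᵢ (T - d₁ - d₂) log₂ q`. -/
def rateRectangle (q T : ℕ) (d : ℕ × ℕ) : Set (ℝ × ℝ) :=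
  {R | (0 ≤ R.1 ∧ R.1 ≤ (d.1 : ℝ) * ((T : ℝ) - d.1 - d.2) * Real.logb 2 q) ∧
       (0 ≤ R.2 ∧ R.2 ≤ (d.2 : ℝ) * ((T : ℝ) - d.1 - d.2) * Real.logb 2 q)}

/-- The convex hull of the union of the rectangles over all admissible pairs of dimensions. -/
def asymptoticRegion (q n m₁ m₂ T : ℕ) : Set (ℝ × ℝ) :=
  convexHull ℝ (⋃ d ∈ dimPairs n m₁ m₂, rateRectangle q T d)

end

open Module Submodule Filter Topology

/-! Given the inputs, the rows of `Y` are independent and uniform on U = `rowSpan X₁ ⊔ rowSpan X₂`.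
Write q for the field size, k for dim U and d₁, d₂ for the ranks of the inputs.

Outer bound. No entropy is used: the channel law is dominated pointwise by reference laws that know
only one input, or neither. For a subspace V ≤ U of dimension d, take the weight that gives a tuple
y the inverse of the approximate number of tuples with the same dim(V + span y). Its total mass is
bounded independently of q (`sum_tupleWeight_le`), and it dominates the channel law up to a constant
times q ^ (min(n, k - d) (T - k)) (`matrixMAC_le_referenceLaw`). Taking V to be the row span of X₂,
the row span of X₁, or zero gives the three multiple access constraints, and
`exists_factors_of_errorProb_lt` makes them hold for one common pair of codewords. Averaged over the
block, they cut out a pentagon whose two dominant corners are averages of points of the rectangles,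
so it lies in the region (`pentagon_mem_asymptoticRegion`). The constants cost n mᵢ bits per use,
which is negligible against log q.

Inner bound. For (d₁, d₂) in `dimPairs`, the sources send [I 0 B₁] and [0 I B₂], padded with zero
rows. The first d₁ + d₂ columns of the output then display the relevant columns of G₁ and G₂; when
these are independent, which fails with probability at most n/q, the output determines B₁ and B₂
(`exists_erasure_scheme`). Both users thus see an erasure channel whose erasures do not depend on
the inputs, and they can be coded separately (`exists_code_errorProb_le`). Random coding with a
fixed exponent ρ and time sharing between the modes (d₁, d₂) reach (1 - ε) times the convex hull. -/

/-! ### Convex geometry of the asymptotic region -/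

theorem le_total_of_mem_dimPairs {n m₁ m₂ T : ℕ} (hT : m₁ + m₂ ≤ T) {d : ℕ × ℕ}
    (hd : d ∈ dimPairs n m₁ m₂) : d.1 + d.2 ≤ T := by
  have := hd.2.2
  omega

theorem coef_nonneg_of_mem_dimPairs {n m₁ m₂ T : ℕ} (hT : m₁ + m₂ ≤ T) {d : ℕ × ℕ}
    (hd : d ∈ dimPairs n m₁ m₂) : (0 : ℝ) ≤ (T : ℝ) - d.1 - d.2 := by
  have : ((d.1 + d.2 : ℕ) : ℝ) ≤ T := by exact_mod_cast le_total_of_mem_dimPairs hT hd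
  push_cast at this
  linarith

theorem finite_dimPairs (n m₁ m₂ : ℕ) : (dimPairs n m₁ m₂).Finite := by
  refine (Set.finite_Iic ((n, n) : ℕ × ℕ)).subset fun d hd => ?_
  obtain ⟨h1, h2, -⟩ := hd
  exact ⟨h1.trans (min_le_left _ _), h2.trans (min_le_left _ _)⟩

theorem logb_card_nonneg (q : ℕ) : 0 ≤ Real.logb 2 (q : ℝ) := by
  rcases Nat.eq_zero_or_pos q with rfl | h
  · simp
  · exact Real.logb_nonneg (by norm_num) (by exact_mod_cast h)

/-- A rectangle with a corner at the origin is the convex hull of its corners. -/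
theorem rectangle_eq_convexHull {a b : ℝ} (ha : 0 ≤ a) (hb : 0 ≤ b) :
    {R : ℝ × ℝ | (0 ≤ R.1 ∧ R.1 ≤ a) ∧ (0 ≤ R.2 ∧ R.2 ≤ b)}
      = convexHull ℝ (({0, a} : Set ℝ) ×ˢ ({0, b} : Set ℝ)) := by
  rw [convexHull_prod, convexHull_pair, convexHull_pair, segment_eq_Icc ha, segment_eq_Icc hb]
  ext R
  simp only [Set.mem_ofPred_eq, Set.mem_prod, Set.mem_Icc]

/-- The region is the convex hull of the finitely many corners of its rectangles. Closedness lets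
the outer bound pass to limits and to the closure in `capacityRegion`. -/
theorem isClosed_asymptoticRegion {n m₁ m₂ T : ℕ} (hT : m₁ + m₂ ≤ T) (q : ℕ) :
    IsClosed (asymptoticRegion q n m₁ m₂ T) := by
  set K : ℕ × ℕ → Set (ℝ × ℝ) := fun d =>
    ({0, (d.1 : ℝ) * ((T : ℝ) - d.1 - d.2) * Real.logb 2 q} : Set ℝ) ×ˢ
      ({0, (d.2 : ℝ) * ((T : ℝ) - d.1 - d.2) * Real.logb 2 q} : Set ℝ) with hK
  have hrect : ∀ d ∈ dimPairs n m₁ m₂, rateRectangle q T d = convexHull ℝ (K d) := fun d hd =>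
    have h := coef_nonneg_of_mem_dimPairs hT hd
    have hl := logb_card_nonneg q
    rectangle_eq_convexHull (by positivity) (by positivity)
  have hfin : (⋃ d ∈ dimPairs n m₁ m₂, K d).Finite :=
    (finite_dimPairs n m₁ m₂).biUnion fun d _ => (Set.toFinite _).prod (Set.toFinite _)
  have : asymptoticRegion q n m₁ m₂ T = convexHull ℝ (⋃ d ∈ dimPairs n m₁ m₂, K d) := by
    refine subset_antisymm (convexHull_min ?_ (convex_convexHull ℝ _)) (convexHull_mono ?_)
    · refine Set.iUnion₂_subset fun d hd => ?_
      rw [hrect d hd]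
      exact convexHull_mono (Set.subset_iUnion₂_of_subset d hd subset_rfl)
    · refine Set.iUnion₂_mono fun d hd => ?_
      rw [hrect d hd]
      exact subset_convexHull ℝ _
  rw [this]
  exact hfin.isClosed_convexHull ℝ

theorem convex_asymptoticRegion (q n m₁ m₂ T : ℕ) : Convex ℝ (asymptoticRegion q n m₁ m₂ T) :=
  convex_convexHull ℝ _

theorem rateRectangle_subset_asymptoticRegion {n m₁ m₂ : ℕ} (q T : ℕ) {d : ℕ × ℕ}
    (hd : d ∈ dimPairs n m₁ m₂) : rateRectangle q T d ⊆ asymptoticRegion q n m₁ m₂ T :=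
  fun _ hR => subset_convexHull ℝ _ (Set.mem_biUnion hd hR)

/-- The region is closed under decreasing the (nonnegative) rates. -/
theorem asymptoticRegion_downward {q n m₁ m₂ T : ℕ} {P R : ℝ × ℝ} (h1 : 0 ≤ P.1) (h2 : 0 ≤ P.2)
    (hP1 : P.1 ≤ R.1) (hP2 : P.2 ≤ R.2) (hR : R ∈ asymptoticRegion q n m₁ m₂ T) :
    P ∈ asymptoticRegion q n m₁ m₂ T := by
  have key : ∀ x y : ℝ, 0 ≤ x → x ≤ y → 0 ≤ x / y ∧ x / y ≤ 1 ∧ x / y * y = x := by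
    intro x y hx hxy
    -- If y = 0 then x = 0 as well, and the convention 0 / 0 = 0 gives the claim.
    rcases eq_or_lt_of_le (hx.trans hxy) with h | h
    · have : x = 0 := by linarith
      simp [this]
    · exact ⟨by positivity, (div_le_one h).2 hxy, div_mul_cancel₀ x h.ne'⟩
  obtain ⟨a0, a1, ae⟩ := key _ _ h1 hP1
  obtain ⟨b0, b1, be⟩ := key _ _ h2 hP2
  set a := P.1 / R.1
  set b := P.2 / R.2
  -- Scaling the coordinates by factors in [0, 1] maps each rectangle, hence the hull, into itself.
  let f : ℝ × ℝ →ₗ[ℝ] ℝ × ℝ := (a • LinearMap.id).prodMap (b • LinearMap.id)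
  have hf : f '' asymptoticRegion q n m₁ m₂ T ⊆ asymptoticRegion q n m₁ m₂ T := by
    rw [asymptoticRegion, f.image_convexHull]
    refine convexHull_mono ?_
    rintro _ ⟨r, hr, rfl⟩
    simp only [Set.mem_iUnion] at hr ⊢
    obtain ⟨d, hd, ⟨hr1, hr1'⟩, hr2, hr2'⟩ := hr
    refine ⟨d, hd, ⟨?_, ?_⟩, ?_, ?_⟩
    · exact mul_nonneg a0 hr1
    · exact (mul_le_of_le_one_left hr1 a1).trans hr1'
    · exact mul_nonneg b0 hr2
    · exact (mul_le_of_le_one_left hr2 b1).trans hr2'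
  have : f R = P := Prod.ext ae be
  exact this ▸ hf ⟨R, hR, rfl⟩

/-- A pentagon of nonnegative rate pairs lies in the region as soon as its two dominant corners
do. -/
theorem pentagon_mem_asymptoticRegion {q n m₁ m₂ T : ℕ} {a₁ a₂ b : ℝ} {P : ℝ × ℝ}
    (h1 : 0 ≤ P.1) (h2 : 0 ≤ P.2) (hP1 : P.1 ≤ a₁) (hP2 : P.2 ≤ a₂) (hP : P.1 + P.2 ≤ b)
    (hc₁ : (a₁, b - a₁) ∈ asymptoticRegion q n m₁ m₂ T)
    (hc₂ : (b - a₂, a₂) ∈ asymptoticRegion q n m₁ m₂ T) :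
    P ∈ asymptoticRegion q n m₁ m₂ T := by
  -- Left of the corner (b - a₂, a₂) the point is dominated by that corner; otherwise it lies below
  -- the point of the segment between the corners with the same first coordinate.
  by_cases hx : P.1 ≤ b - a₂
  · exact asymptoticRegion_downward h1 h2 hx hP2 hc₂
  push Not at hx
  have hpos : 0 < a₁ - (b - a₂) := by linarith
  set θ := (P.1 - (b - a₂)) / (a₁ - (b - a₂)) with hθ
  have hθe : θ * (a₁ - (b - a₂)) = P.1 - (b - a₂) := div_mul_cancel₀ _ hpos.ne'
  have hθ0 : 0 ≤ θ := div_nonneg (by linarith) hpos.le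
  have hθ1 : θ ≤ 1 := (div_le_one hpos).2 (by linarith)
  have hmem := convex_asymptoticRegion q n m₁ m₂ T hc₁ hc₂ hθ0 (sub_nonneg.2 hθ1)
    (add_sub_cancel θ 1)
  refine asymptoticRegion_downward h1 h2 ?_ ?_ hmem
  · simp only [Prod.fst_add, Prod.smul_fst, smul_eq_mul]
    linarith
  · simp only [Prod.snd_add, Prod.smul_snd, smul_eq_mul]
    linarith

/-- The pair of fixed additive terms is a small multiple of a point of the region when `q` is
large. -/
theorem exists_overhead_mem_asymptoticRegion {q n m₁ m₂ T : ℕ} (hT : m₁ + m₂ + 1 ≤ T) {ε : ℝ}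
    (hε : 0 < ε) (hq : (2 * n * (m₁ + m₂) / ε : ℝ) ≤ Real.logb 2 q) :
    ∃ z ∈ asymptoticRegion q n m₁ m₂ T, ((n * m₁ : ℝ), (n * m₂ : ℝ)) = ε • z := by
  have hε' := hε.ne'
  have hl := logb_card_nonneg q
  have hTL : 1 ≤ m₁ + m₂ → 1 * Real.logb 2 q ≤ (1 : ℝ) * ((T : ℝ) - 1) * Real.logb 2 q := by
    intro hi
    have : (2 : ℝ) ≤ T := by exact_mod_cast (by omega : 2 ≤ T)
    gcongr
    linarith
  rw [div_le_iff₀ hε] at hq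
  -- The overhead is split between the axes: z is the midpoint of two points, taken from the
  -- rectangles of (1, 0) and (0, 1), whose side (T - 1) log q is at least log q. When a mode is
  -- unavailable, its coordinate is 0.
  have h1 : ((2 * (n * m₁) / ε : ℝ), (0 : ℝ)) ∈ asymptoticRegion q n m₁ m₂ T := by
    by_cases h : 1 ≤ n ∧ 1 ≤ m₁
    · refine rateRectangle_subset_asymptoticRegion q T (d := (1, 0)) ⟨?_, ?_, ?_⟩ ⟨⟨?_, ?_⟩, ?_, ?_⟩
      · simp [h.1, h.2]
      · simp
      · simp; omega
      · positivity
      · have := hTL (by omega)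
        simp only [Nat.cast_one, Nat.cast_zero, sub_zero]
        refine le_trans ?_ this
        rw [div_le_iff₀ hε]
        have : (0 : ℝ) ≤ n * m₂ := by positivity
        nlinarith
      · simp
      · simp
    · refine rateRectangle_subset_asymptoticRegion q T (d := (0, 0)) ⟨?_, ?_, ?_⟩ ⟨⟨?_, ?_⟩, ?_, ?_⟩
      all_goals try simp
      · positivity
      · have : (n : ℝ) * m₁ = 0 := by
          have : n * m₁ = 0 := by
            rcases Nat.eq_zero_or_pos n with rfl | hn
            · simp
            · have : m₁ = 0 := by omega
              simp [this]
          exact_mod_cast this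
        simp [this]
  have h2 : ((0 : ℝ), (2 * (n * m₂) / ε : ℝ)) ∈ asymptoticRegion q n m₁ m₂ T := by
    by_cases h : 1 ≤ n ∧ 1 ≤ m₂
    · refine rateRectangle_subset_asymptoticRegion q T (d := (0, 1)) ⟨?_, ?_, ?_⟩ ⟨⟨?_, ?_⟩, ?_, ?_⟩
      · simp
      · simp [h.1, h.2]
      · simp; omega
      · simp
      · simp
      · positivity
      · have := hTL (by omega)
        simp only [Nat.cast_one, Nat.cast_zero, sub_zero]
        refine le_trans ?_ this
        rw [div_le_iff₀ hε]
        have : (0 : ℝ) ≤ n * m₁ := by positivity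
        nlinarith
    · refine rateRectangle_subset_asymptoticRegion q T (d := (0, 0)) ⟨?_, ?_, ?_⟩ ⟨⟨?_, ?_⟩, ?_, ?_⟩
      all_goals try simp
      · positivity
      · have : (n : ℝ) * m₂ = 0 := by
          have : n * m₂ = 0 := by
            rcases Nat.eq_zero_or_pos n with rfl | hn
            · simp
            · have : m₂ = 0 := by omega
              simp [this]
          exact_mod_cast this
        simp [this]
  refine ⟨_, convex_asymptoticRegion q n m₁ m₂ T h1 h2 (by norm_num : (0 : ℝ) ≤ 1 / 2)
    (by norm_num : (0 : ℝ) ≤ 1 / 2) (by norm_num), ?_⟩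
  ext <;> simp <;> field_simp

/-- Adding a small multiple of a point of the region to another of its points. -/
theorem mem_smul_asymptoticRegion {q n m₁ m₂ T : ℕ} {ε : ℝ} (hε : 0 < ε) {R P z : ℝ × ℝ}
    (h1 : 0 ≤ R.1) (h2 : 0 ≤ R.2) (hP : P ∈ asymptoticRegion q n m₁ m₂ T)
    (hz : z ∈ asymptoticRegion q n m₁ m₂ T) (hR1 : R.1 ≤ P.1 + ε * z.1)
    (hR2 : R.2 ≤ P.2 + ε * z.2) : R ∈ (1 + ε) • asymptoticRegion q n m₁ m₂ T := by
  have hpos : 0 < 1 + ε := by linarith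
  rw [Set.mem_smul_set_iff_inv_smul_mem₀ hpos.ne']
  -- (P + ε z) / (1 + ε) is a convex combination of P and z.
  have hmem := convex_asymptoticRegion q n m₁ m₂ T hP hz (inv_nonneg.2 hpos.le)
    (by positivity : 0 ≤ (1 + ε)⁻¹ * ε) (by field_simp)
  refine asymptoticRegion_downward ?_ ?_ ?_ ?_ hmem
  · exact mul_nonneg (by positivity) h1
  · exact mul_nonneg (by positivity) h2
  · simp only [Prod.fst_add, Prod.smul_fst, smul_eq_mul, mul_assoc, ← mul_add]
    gcongr
  · simp only [Prod.snd_add, Prod.smul_snd, smul_eq_mul, mul_assoc, ← mul_add]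
    gcongr

/-! ### Uniform laws and additive maps -/

theorem map_uniform_toReal {α β : Type*} [Fintype α] [Nonempty α] [DecidableEq β] (f : α → β)
    (y : β) : (((PMF.uniformOfFintype α).map f) y).toReal
      = ((Finset.univ.filter fun a => f a = y).card : ℝ) / Fintype.card α := by
  rw [PMF.map_apply, tsum_fintype]
  simp only [PMF.uniformOfFintype_apply, eq_comm (a := y)]
  rw [← Finset.sum_filter, Finset.sum_const, nsmul_eq_mul, ENNReal.toReal_mul]
  simp [div_eq_mul_inv]

theorem sum_map_uniform {α β : Type*} [Fintype α] [Nonempty α] [Fintype β]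
    (f : α → β) (g : β → ℝ) :
    ∑ y, (((PMF.uniformOfFintype α).map f) y).toReal * g y
      = (∑ a, g (f a)) / Fintype.card α := by
  classical
  simp only [map_uniform_toReal]
  rw [Finset.sum_div, ← Finset.sum_fiberwise Finset.univ f]
  refine Finset.sum_congr rfl fun y _ => ?_
  rw [Finset.sum_congr rfl (g := fun _ => g y / Fintype.card α)
    (fun a ha => by rw [(Finset.mem_filter.1 ha).2]), Finset.sum_const, nsmul_eq_mul]
  ring

/-- All nonempty fibres of a homomorphism have the same size, so the image of a uniform law is
uniform on the range. -/
theorem card_fiber_mul_card_range {G H : Type*} [AddGroup G] [Fintype G] [AddGroup H]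
    [DecidableEq H] (f : G →+ H) {y : H} (hy : y ∈ Set.range f) :
    (Finset.univ.filter fun a => f a = y).card * Nat.card f.range = Fintype.card G := by
  classical
  have h := Finset.card_eq_sum_card_image f (Finset.univ : Finset G)
  rw [Finset.sum_congr rfl (g := fun _ => (Finset.univ.filter fun a => f a = y).card)] at h
  · rw [← Finset.card_univ, h, Finset.sum_const, smul_eq_mul, mul_comm]
    congr 1
    have : ((Finset.univ.image f : Finset H) : Set H) = (f.range : Set H) := by
      ext; simp
    rw [← Set.ncard_coe_finset, this]
    rfl
  · intro b hb
    obtain ⟨a, -, rfl⟩ := Finset.mem_image.1 hb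
    exact AddMonoidHom.card_fiber_eq_of_mem_range f ⟨a, rfl⟩ hy

/-! ### The law of the channel -/

section Law

variable {F : Type*} [Field F] [Fintype F] [DecidableEq F] {n m₁ m₂ T : ℕ}

/-- The span of the rows of a matrix. -/
abbrev rowSpan {m : ℕ} (X : Matrix (Fin m) (Fin T) F) : Submodule F (Fin T → F) :=
  span F (Set.range X.row)

/-- The linear map sending the channel matrices to the output. -/
def outputHom (n : ℕ) (X₁ : Matrix (Fin m₁) (Fin T) F) (X₂ : Matrix (Fin m₂) (Fin T) F) :
    (Matrix (Fin n) (Fin m₁) F × Matrix (Fin n) (Fin m₂) F) →+ Matrix (Fin n) (Fin T) F where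
  toFun G := G.1 * X₁ + G.2 * X₂
  map_zero' := by simp
  map_add' G G' := by
    simp only [Prod.fst_add, Prod.snd_add, Matrix.add_mul]
    abel

omit [Fintype F] [DecidableEq F] in
theorem mem_rowSpan_iff {m : ℕ} (X : Matrix (Fin m) (Fin T) F) (v : Fin T → F) :
    v ∈ rowSpan X ↔ ∃ c : Fin m → F, Matrix.vecMul c X = v := by
  rw [rowSpan, mem_span_range_iff_exists_fun]
  simp only [Matrix.vecMul_eq_sum]
  rfl

omit [Fintype F] [DecidableEq F] in
theorem mem_range_outputHom_iff (X₁ : Matrix (Fin m₁) (Fin T) F) (X₂ : Matrix (Fin m₂) (Fin T) F)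
    (y : Matrix (Fin n) (Fin T) F) :
    y ∈ (outputHom n X₁ X₂).range ↔ ∀ i, y i ∈ rowSpan X₁ ⊔ rowSpan X₂ := by
  constructor
  · rintro ⟨G, rfl⟩ i
    refine mem_sup.2 ⟨_, (mem_rowSpan_iff X₁ _).2 ⟨G.1 i, rfl⟩, _,
      (mem_rowSpan_iff X₂ _).2 ⟨G.2 i, rfl⟩, ?_⟩
    rfl
  · intro h
    have : ∀ i, ∃ c₁ : Fin m₁ → F, ∃ c₂ : Fin m₂ → F,
        Matrix.vecMul c₁ X₁ + Matrix.vecMul c₂ X₂ = y i := by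
      intro i
      obtain ⟨_, h1, _, h2, h3⟩ := mem_sup.1 (h i)
      obtain ⟨c₁, rfl⟩ := (mem_rowSpan_iff X₁ _).1 h1
      obtain ⟨c₂, rfl⟩ := (mem_rowSpan_iff X₂ _).1 h2
      exact ⟨c₁, c₂, h3⟩
    choose c₁ c₂ hc using this
    refine ⟨(c₁, c₂), ?_⟩
    ext i j
    rw [← hc i]
    rfl

omit [DecidableEq F] in
theorem card_range_outputHom (X₁ : Matrix (Fin m₁) (Fin T) F) (X₂ : Matrix (Fin m₂) (Fin T) F) :
    Nat.card (outputHom n X₁ X₂).range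
      = Fintype.card F ^ (n * finrank F ↥(rowSpan X₁ ⊔ rowSpan X₂)) := by
  have e : (outputHom n X₁ X₂).range ≃ (Fin n → ↥(rowSpan X₁ ⊔ rowSpan X₂)) :=
    { toFun := fun y i => ⟨y.1 i, (mem_range_outputHom_iff X₁ X₂ y.1).1 y.2 i⟩
      invFun := fun u => ⟨fun i => u i, (mem_range_outputHom_iff X₁ X₂ _).2 fun i => (u i).2⟩
      left_inv := fun y => rfl
      right_inv := fun u => rfl }
  rw [Nat.card_congr e, Nat.card_fun, Module.natCard_eq_pow_finrank (K := F)]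
  simp [← pow_mul, mul_comm]

theorem matrixMAC_toReal (X₁ : Matrix (Fin m₁) (Fin T) F) (X₂ : Matrix (Fin m₂) (Fin T) F)
    (y : Matrix (Fin n) (Fin T) F) (hy : ∀ i, y i ∈ rowSpan X₁ ⊔ rowSpan X₂) :
    (matrixMAC F n m₁ m₂ T X₁ X₂ y).toReal
      = ((Fintype.card F : ℝ) ^ (n * finrank F ↥(rowSpan X₁ ⊔ rowSpan X₂)))⁻¹ := by
  have h := card_fiber_mul_card_range (outputHom n X₁ X₂) (y := y)
    ((mem_range_outputHom_iff X₁ X₂ y).2 hy)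
  rw [card_range_outputHom] at h
  have hq : (0 : ℝ) < Fintype.card F := by exact_mod_cast Fintype.card_pos
  rw [matrixMAC, map_uniform_toReal, ← h]
  push_cast
  have hne : ((Finset.univ.filter fun a => outputHom n X₁ X₂ a = y).card : ℝ) ≠ 0 := by
    intro h0
    rw [Nat.cast_eq_zero] at h0
    rw [h0, zero_mul] at h
    exact Fintype.card_ne_zero h.symm
  exact div_mul_cancel_left₀ hne _

theorem matrixMAC_eq_zero (X₁ : Matrix (Fin m₁) (Fin T) F) (X₂ : Matrix (Fin m₂) (Fin T) F)
    (y : Matrix (Fin n) (Fin T) F) (hy : ¬ ∀ i, y i ∈ rowSpan X₁ ⊔ rowSpan X₂) :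
    (matrixMAC F n m₁ m₂ T X₁ X₂ y).toReal = 0 := by
  rw [matrixMAC, map_uniform_toReal, Finset.filter_eq_empty_iff.2]
  · simp
  · intro G _ hG
    exact hy ((mem_range_outputHom_iff X₁ X₂ y).1 ⟨G, hG⟩)

end Law

/-! ### Counting tuples by the dimension they add to a subspace -/

section Weight

/-- The exponent of the number of `n`-tuples that together with a fixed `d`-dimensional subspace of
a `D`-dimensional space span a subspace of dimension `f`. -/
def tupleExp (D n d f : ℕ) : ℤ := n * d + ((f : ℤ) - d) * (n + D - f)

variable {F E : Type*} [Field F] [Fintype F] [AddCommGroup E] [Module F E]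

/-- A subprobability weight on `n`-tuples, roughly uniform on those that add a given dimension to
the subspace `V`, and vanishing on those adding more than `m` dimensions. -/
noncomputable def tupleWeight {n : ℕ} (m : ℕ) (V : Submodule F E) (y : Fin n → E) : ℝ :=
  open Classical in
  if finrank F ↥(V ⊔ span F (Set.range y)) ≤ finrank F V + m then
    (Fintype.card F : ℝ) ^ (-tupleExp (finrank F E) n (finrank F V)
      (finrank F ↥(V ⊔ span F (Set.range y)))) else 0

theorem tupleWeight_nonneg {n : ℕ} (m : ℕ) (V : Submodule F E) (y : Fin n → E) :
    0 ≤ tupleWeight m V y := by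
  unfold tupleWeight
  split_ifs <;> positivity

omit [Fintype F] in
theorem sup_span_cons {n : ℕ} (V : Submodule F E) (v : E) (y : Fin n → E) :
    V ⊔ span F (Set.range (Fin.cons v y : Fin (n + 1) → E))
      = (V ⊔ span F {v}) ⊔ span F (Set.range y) := by
  rw [Fin.range_cons, span_insert, sup_assoc]

/-- Induction on the first vector v. If v ∈ V, there are q ^ dim V choices, each costing a factor at
most q ^ (-dim V). If v ∉ V, there are at most q ^ dim E choices, each costing exactly q ^ (-dim E),
while V grows and m drops by one. So the sums satisfy S(n + 1, m) ≤ S(n, m) + S(n, m - 1), without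
the last term when m = 0. The point is that the bound is free of q. -/
theorem sum_tupleWeight_le [Fintype E] (n m : ℕ) (V : Submodule F E) :
    ∑ y : Fin n → E, tupleWeight m V y ≤ 2 ^ (n * m) := by
  classical
  have hq : (1 : ℝ) ≤ Fintype.card F := by exact_mod_cast Fintype.card_pos
  have hq0 : (0 : ℝ) < Fintype.card F := by linarith
  induction n generalizing m V with
  | zero =>
    have hV : ∀ y : Fin 0 → E, V ⊔ span F (Set.range y) = V := fun y => by
      rw [Set.range_eq_empty, span_empty, sup_bot_eq]
    rw [Fintype.sum_unique, tupleWeight, hV]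
    simp [tupleExp]
  | succ n ih =>
    rw [← (Fin.consEquiv fun _ => E).sum_comp, Fintype.sum_prod_type]
    simp only [Fin.consEquiv, Equiv.coe_fn_mk]
    have hin : ∀ v ∈ V, ∑ y : Fin n → E, tupleWeight m V (Fin.cons v y : Fin (n + 1) → E)
        ≤ ((Fintype.card F : ℝ) ^ finrank F V)⁻¹ * 2 ^ (n * m) := by
      intro v hv
      refine le_trans ?_ (mul_le_mul_of_nonneg_left (ih m V) (by positivity))
      rw [Finset.mul_sum]
      refine Finset.sum_le_sum fun y _ => ?_
      have hV : V ⊔ span F {v} = V := sup_eq_left.2 ((span_singleton_le_iff_mem _ _).2 hv)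
      rw [tupleWeight, tupleWeight, sup_span_cons, hV]
      split_ifs with h
      · rw [← zpow_natCast, ← zpow_neg, ← zpow_add₀ hq0.ne']
        refine zpow_le_zpow_right₀ hq ?_
        have : finrank F V ≤ finrank F ↥(V ⊔ span F (Set.range y)) :=
          finrank_mono le_sup_left
        simp only [tupleExp]
        push_cast
        have : (finrank F V : ℤ) ≤ finrank F ↥(V ⊔ span F (Set.range y)) := by exact_mod_cast this
        nlinarith
      · simp
    have hout : ∀ v ∉ V, ∑ y : Fin n → E, tupleWeight m V (Fin.cons v y : Fin (n + 1) → E)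
        ≤ ((Fintype.card F : ℝ) ^ finrank F E)⁻¹ * (if m = 0 then 0 else 2 ^ (n * (m - 1))) := by
      intro v hv
      have hd : finrank F ↥(V ⊔ span F {v}) = finrank F V + 1 :=
        finrank_sup_span_singleton hv
      rcases Nat.eq_zero_or_pos m with rfl | hm
      · simp only [if_true, mul_zero]
        refine (Finset.sum_eq_zero fun y _ => ?_).le
        rw [tupleWeight, sup_span_cons, if_neg]
        have : finrank F ↥(V ⊔ span F {v}) ≤ finrank F ↥(V ⊔ span F {v} ⊔ span F (Set.range y)) :=
          finrank_mono le_sup_left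
        omega
      · rw [if_neg hm.ne']
        refine le_trans ?_ (mul_le_mul_of_nonneg_left (ih (m - 1) (V ⊔ span F {v}))
          (by positivity))
        rw [Finset.mul_sum]
        refine Finset.sum_le_sum fun y _ => ?_
        rw [tupleWeight, tupleWeight, sup_span_cons, hd]
        have : finrank F V + 1 + (m - 1) = finrank F V + m := by omega
        rw [this]
        split_ifs with h
        · rw [← zpow_natCast, ← zpow_neg, ← zpow_add₀ hq0.ne']
          refine (congrArg _ ?_).le
          simp only [tupleExp]
          push_cast
          ring
        · simp
    have hcardV : ((Finset.univ.filter fun v => v ∈ V).card : ℝ)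
        = (Fintype.card F : ℝ) ^ finrank F V := by
      have h := Module.card_eq_pow_finrank (K := F) (V := V)
      rw [Fintype.card_subtype] at h
      exact_mod_cast h
    have hcardE : ((Finset.univ.filter fun v => v ∉ V).card : ℝ)
        ≤ (Fintype.card F : ℝ) ^ finrank F E := by
      have h := Module.card_eq_pow_finrank (K := F) (V := E)
      exact_mod_cast (Finset.card_le_univ _).trans h.le
    rw [← Finset.sum_filter_add_sum_filter_not Finset.univ fun v => v ∈ V]
    have h1 := Finset.sum_le_card_nsmul (Finset.univ.filter fun v => v ∈ V) _ _
      fun v hv => hin v (Finset.mem_filter.1 hv).2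
    have h2 := Finset.sum_le_card_nsmul (Finset.univ.filter fun v => v ∉ V) _ _
      fun v hv => hout v (Finset.mem_filter.1 hv).2
    rw [nsmul_eq_mul] at h1 h2
    rw [hcardV, mul_inv_cancel_left₀ (by positivity)] at h1
    have h3 := h2.trans (mul_le_mul_of_nonneg_right hcardE (by split_ifs <;> positivity))
    rw [mul_inv_cancel_left₀ (by positivity)] at h3
    refine (add_le_add h1 h3).trans ?_
    rcases Nat.eq_zero_or_pos m with rfl | hm
    · simp
    · rw [if_neg hm.ne']
      have e : n * m = n * (m - 1) + n := by
        conv_lhs => rw [← Nat.sub_add_cancel hm]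
        ring
      have h4 : (2 : ℝ) ^ (n * (m - 1)) ≤ 2 ^ (n * m) :=
        pow_le_pow_right₀ (by norm_num) (by omega)
      have h5 : (2 : ℝ) ^ (n * m) * 2 ≤ 2 ^ ((n + 1) * m) := by
        rw [← pow_succ]
        exact pow_le_pow_right₀ (by norm_num) (by nlinarith)
      linarith

omit [Fintype F] in
theorem finrank_sup_span_le_add [Finite E] {n : ℕ} (V : Submodule F E) (y : Fin n → E) :
    finrank F ↥(V ⊔ span F (Set.range y)) ≤ finrank F V + n := by
  have h := finrank_add_le_finrank_add_finrank V (span F (Set.range y))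
  have := finrank_range_le_card (R := F) y
  rw [Fintype.card_fin] at this
  exact h.trans (by gcongr; exact this)

/-- The uniform law on tuples from `U` is dominated by the weight relative to `V ≤ U`. -/
theorem inv_card_pow_le_tupleWeight [Finite E] {n m : ℕ} {U V : Submodule F E} (hVU : V ≤ U)
    (hm : finrank F U ≤ finrank F V + m) (y : Fin n → E) (hy : ∀ i, y i ∈ U) :
    ((Fintype.card F : ℝ) ^ (n * finrank F U))⁻¹ ≤
      (Fintype.card F : ℝ) ^ (min n (finrank F U - finrank F V) * (finrank F E - finrank F U))
        * tupleWeight m V y := by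
  have hq : (1 : ℝ) ≤ Fintype.card F := by exact_mod_cast Fintype.card_pos
  have hq0 : (0 : ℝ) < Fintype.card F := by linarith
  have hfU : finrank F ↥(V ⊔ span F (Set.range y)) ≤ finrank F U :=
    finrank_mono (sup_le hVU (span_le.2 (by rintro _ ⟨i, rfl⟩; exact hy i)))
  have hVf : finrank F V ≤ finrank F ↥(V ⊔ span F (Set.range y)) := finrank_mono le_sup_left
  have hfn := finrank_sup_span_le_add V y
  have hUE : finrank F U ≤ finrank F E := finrank_le U
  rw [tupleWeight, if_pos (hfU.trans hm)]
  generalize finrank F ↥(V ⊔ span F (Set.range y)) = f at *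
  generalize finrank F V = d at *
  generalize finrank F U = k at *
  generalize finrank F E = D at *
  rw [← zpow_natCast, ← zpow_natCast, ← zpow_neg, ← zpow_add₀ hq0.ne']
  refine zpow_le_zpow_right₀ hq ?_
  -- With a = f - d, b = k - f, c = D - k, the required inequality of exponents is a c - b (n - a) ≤
  -- min(n, a + b) c. It holds because a is at most both n and a + b.
  obtain ⟨a, rfl⟩ := Nat.exists_eq_add_of_le hVf
  obtain ⟨b, rfl⟩ := Nat.exists_eq_add_of_le hfU
  obtain ⟨c, rfl⟩ := Nat.exists_eq_add_of_le hUE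
  have e1 : d + a + b + c - (d + a + b) = c := by omega
  have e2 : d + a + b - d = a + b := by omega
  rw [e1, e2]
  simp only [tupleExp]
  rcases le_total n (a + b) with h | h
  · rw [min_eq_left h]
    obtain ⟨i, rfl⟩ := Nat.exists_eq_add_of_le (by omega : a ≤ n)
    push_cast
    obtain ⟨j, rfl⟩ := Nat.exists_eq_add_of_le (by omega : i ≤ b)
    push_cast
    nlinarith [mul_nonneg (Int.natCast_nonneg i) (Int.natCast_nonneg c),
      mul_nonneg (Int.natCast_nonneg i) (Int.natCast_nonneg j)]
  · rw [min_eq_right h]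
    obtain ⟨i, rfl⟩ := Nat.exists_eq_add_of_le h
    push_cast
    nlinarith [mul_nonneg (Int.natCast_nonneg b) (Int.natCast_nonneg c),
      mul_nonneg (Int.natCast_nonneg b) (Int.natCast_nonneg i)]

end Weight

/-! ### The converse -/

section Converse

variable {A B C : Type*} [Fintype C]

theorem sum_pmf_toReal (p : PMF C) : ∑ y, (p y).toReal = 1 := by
  have h := p.tsum_coe
  rw [tsum_fintype] at h
  rw [← ENNReal.toReal_sum fun y _ => p.apply_ne_top y, h, ENNReal.toReal_one]

theorem blockProb_nonneg {C : Type*} (W : A → B → PMF C) {N : ℕ} (a : Fin N → A) (b : Fin N → B)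
    (y : Fin N → C) : 0 ≤ blockProb W a b y :=
  Finset.prod_nonneg fun _ _ => ENNReal.toReal_nonneg

theorem sum_blockProb (W : A → B → PMF C) {N : ℕ} (a : Fin N → A) (b : Fin N → B) :
    ∑ y, blockProb W a b y = 1 := by
  classical
  simp only [blockProb]
  rw [← Fintype.piFinset_univ, Finset.sum_prod_piFinset Finset.univ fun t y => (W (a t) (b t) y).toReal]
  exact Finset.prod_eq_one fun t _ => sum_pmf_toReal _

/-- The error probability is one minus the average probability of correct decoding. -/
theorem errorProb_eq (W : A → B → PMF C) {N M₁ M₂ : ℕ} (c : MACCode A B C N M₁ M₂)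
    (h1 : 0 < M₁) (h2 : 0 < M₂) :
    c.errorProb W = 1 - (∑ y, blockProb W (c.enc₁ (c.dec y).1) (c.enc₂ (c.dec y).2) y)
      / ((M₁ : ℝ) * M₂) := by
  have hM : (0 : ℝ) < (M₁ : ℝ) * M₂ := by positivity
  rw [MACCode.errorProb, eq_sub_iff_add_eq, ← add_div, div_eq_one_iff_eq hM.ne']
  have h : ∑ y, blockProb W (c.enc₁ (c.dec y).1) (c.enc₂ (c.dec y).2) y
      = ∑ w : Fin M₁ × Fin M₂, ∑ y, if c.dec y = w then
        blockProb W (c.enc₁ w.1) (c.enc₂ w.2) y else 0 := by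
    rw [Finset.sum_comm]
    simp
  rw [h, ← Finset.sum_add_distrib]
  simp only [← Finset.sum_add_distrib]
  rw [Finset.sum_congr rfl (g := fun _ => (1 : ℝ)) fun w _ => ?_]
  · simp
  · rw [← sum_blockProb W (c.enc₁ w.1) (c.enc₂ w.2)]
    refine Finset.sum_congr rfl fun y _ => ?_
    split_ifs <;> simp

/-- If the block law is dominated by reference laws that forget the first message, the second one,
or both, then a code with small error probability has a pair of messages for which the three
domination factors exceed a fixed multiple of the numbers of messages. -/
theorem exists_factors_of_errorProb_lt (W : A → B → PMF C) {N M₁ M₂ : ℕ}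
    (c : MACCode A B C N M₁ M₂) (h1 : 0 < M₁) (h2 : 0 < M₂)
    (q₁ : Fin M₂ → (Fin N → C) → ℝ) (q₂ : Fin M₁ → (Fin N → C) → ℝ) (q₀ : (Fin N → C) → ℝ)
    (hq₁ : ∀ w y, 0 ≤ q₁ w y) (hq₂ : ∀ w y, 0 ≤ q₂ w y) (hq₀ : ∀ y, 0 ≤ q₀ y)
    (hs₁ : ∀ w, ∑ y, q₁ w y ≤ 1) (hs₂ : ∀ w, ∑ y, q₂ w y ≤ 1) (hs₀ : ∑ y, q₀ y ≤ 1)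
    (a₁ a₂ b : Fin M₁ → Fin M₂ → ℝ)
    (ha₁ : ∀ w₁ w₂ y, blockProb W (c.enc₁ w₁) (c.enc₂ w₂) y ≤ a₁ w₁ w₂ * q₁ w₂ y)
    (ha₂ : ∀ w₁ w₂ y, blockProb W (c.enc₁ w₁) (c.enc₂ w₂) y ≤ a₂ w₁ w₂ * q₂ w₁ y)
    (hb : ∀ w₁ w₂ y, blockProb W (c.enc₁ w₁) (c.enc₂ w₂) y ≤ b w₁ w₂ * q₀ y)
    (herr : c.errorProb W < 1 / 4) :
    ∃ w₁ w₂, (M₁ : ℝ) / 4 < a₁ w₁ w₂ ∧ (M₂ : ℝ) / 4 < a₂ w₁ w₂ ∧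
      (M₁ : ℝ) * M₂ / 4 < b w₁ w₂ := by
  by_contra! hcon
  have hM : (0 : ℝ) < (M₁ : ℝ) * M₂ := by positivity
  rw [errorProb_eq W c h1 h2] at herr
  have hsum : ∑ y, blockProb W (c.enc₁ (c.dec y).1) (c.enc₂ (c.dec y).2) y
      ≤ ∑ y, ((M₁ : ℝ) / 4 * ∑ w, q₁ w y + (M₂ : ℝ) / 4 * ∑ w, q₂ w y
        + (M₁ : ℝ) * M₂ / 4 * q₀ y) := by
    -- At the decoded pair one of the three factors is small, so one of the three terms alone
    -- dominates. Each term contributes at most a quarter of M₁ M₂ in total, whereas correct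
    -- decoding has mass above three quarters.
    refine Finset.sum_le_sum fun y _ => ?_
    set w₁ := (c.dec y).1
    set w₂ := (c.dec y).2
    have s1 : (0 : ℝ) ≤ (M₁ : ℝ) / 4 * ∑ w, q₁ w y :=
      mul_nonneg (by positivity) (Finset.sum_nonneg fun w _ => hq₁ w y)
    have s2 : (0 : ℝ) ≤ (M₂ : ℝ) / 4 * ∑ w, q₂ w y :=
      mul_nonneg (by positivity) (Finset.sum_nonneg fun w _ => hq₂ w y)
    have s3 : (0 : ℝ) ≤ (M₁ : ℝ) * M₂ / 4 * q₀ y := mul_nonneg (by positivity) (hq₀ y)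
    rcases le_or_gt (a₁ w₁ w₂) ((M₁ : ℝ) / 4) with h | h
    · have := (ha₁ w₁ w₂ y).trans (mul_le_mul h
        (Finset.single_le_sum (fun w _ => hq₁ w y) (Finset.mem_univ w₂)) (hq₁ _ _) (by positivity))
      linarith
    rcases le_or_gt (a₂ w₁ w₂) ((M₂ : ℝ) / 4) with h' | h'
    · have := (ha₂ w₁ w₂ y).trans (mul_le_mul h'
        (Finset.single_le_sum (fun w _ => hq₂ w y) (Finset.mem_univ w₁)) (hq₂ _ _) (by positivity))
      linarith
    have := (hb w₁ w₂ y).trans (mul_le_mul_of_nonneg_right (hcon _ _ h h') (hq₀ y))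
    linarith
  have hq : ∑ y, ((M₁ : ℝ) / 4 * ∑ w, q₁ w y + (M₂ : ℝ) / 4 * ∑ w, q₂ w y
      + (M₁ : ℝ) * M₂ / 4 * q₀ y) ≤ 3 / 4 * ((M₁ : ℝ) * M₂) := by
    rw [Finset.sum_add_distrib, Finset.sum_add_distrib, ← Finset.mul_sum, ← Finset.mul_sum,
      ← Finset.mul_sum, Finset.sum_comm (f := fun y w => q₁ w y),
      Finset.sum_comm (f := fun y w => q₂ w y)]
    have t1 : ∑ w, ∑ y, q₁ w y ≤ M₂ := by
      simpa using Finset.sum_le_sum fun w (_ : w ∈ Finset.univ) => hs₁ w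
    have t2 : ∑ w, ∑ y, q₂ w y ≤ M₁ := by
      simpa using Finset.sum_le_sum fun w (_ : w ∈ Finset.univ) => hs₂ w
    have u1 := mul_le_mul_of_nonneg_left t1 (by positivity : (0 : ℝ) ≤ (M₁ : ℝ) / 4)
    have u2 := mul_le_mul_of_nonneg_left t2 (by positivity : (0 : ℝ) ≤ (M₂ : ℝ) / 4)
    have u3 := mul_le_mul_of_nonneg_left hs₀ (by positivity : (0 : ℝ) ≤ (M₁ : ℝ) * M₂ / 4)
    linarith
  have := (div_le_iff₀ hM).2 (hsum.trans hq)
  linarith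

end Converse

/-! ### Domination of the channel law -/

section Domination

variable {F : Type*} [Field F] [Fintype F] [DecidableEq F] {n m₁ m₂ T : ℕ}

/-- The weight of `tupleWeight`, normalised to a subprobability, as a law on outputs. -/
noncomputable def referenceLaw (n m : ℕ) (V : Submodule F (Fin T → F))
    (y : Matrix (Fin n) (Fin T) F) : ℝ :=
  tupleWeight m V y.row / 2 ^ (n * m)

omit [DecidableEq F] in
theorem referenceLaw_nonneg (m : ℕ) (V : Submodule F (Fin T → F))
    (y : Matrix (Fin n) (Fin T) F) : 0 ≤ referenceLaw n m V y :=
  div_nonneg (tupleWeight_nonneg _ _ _) (by positivity)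

omit [DecidableEq F] in
theorem sum_referenceLaw_le (m : ℕ) (V : Submodule F (Fin T → F)) :
    ∑ y, referenceLaw n m V y ≤ 1 := by
  simp only [referenceLaw]
  rw [← Finset.sum_div]
  exact div_le_one_of_le₀ (sum_tupleWeight_le n m V) (by positivity)

/-- The rank of the stacked input matrices. -/
noncomputable abbrev jointRank (X₁ : Matrix (Fin m₁) (Fin T) F)
    (X₂ : Matrix (Fin m₂) (Fin T) F) : ℕ := finrank F ↥(rowSpan X₁ ⊔ rowSpan X₂)

theorem matrixMAC_le_referenceLaw {m : ℕ} (X₁ : Matrix (Fin m₁) (Fin T) F)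
    (X₂ : Matrix (Fin m₂) (Fin T) F) {V : Submodule F (Fin T → F)}
    (hV : V ≤ rowSpan X₁ ⊔ rowSpan X₂) (hm : jointRank X₁ X₂ ≤ finrank F V + m)
    (y : Matrix (Fin n) (Fin T) F) :
    (matrixMAC F n m₁ m₂ T X₁ X₂ y).toReal ≤
      2 ^ (n * m) * (Fintype.card F : ℝ) ^
        (min n (jointRank X₁ X₂ - finrank F V) * (T - jointRank X₁ X₂)) * referenceLaw n m V y := by
  by_cases hy : ∀ i, y i ∈ rowSpan X₁ ⊔ rowSpan X₂
  · rw [matrixMAC_toReal X₁ X₂ y hy, referenceLaw]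
    have h := inv_card_pow_le_tupleWeight hV hm y.row hy
    rw [Module.finrank_fintype_fun_eq_card, Fintype.card_fin] at h
    refine h.trans (le_of_eq ?_)
    field_simp
  · rw [matrixMAC_eq_zero X₁ X₂ y hy]
    have := referenceLaw_nonneg m V y
    positivity

omit [Fintype F] [DecidableEq F] in
theorem finrank_rowSpan_le {m : ℕ} (X : Matrix (Fin m) (Fin T) F) :
    finrank F (rowSpan X) ≤ m := by
  exact (finrank_range_le_card (R := F) X.row).trans_eq (Fintype.card_fin m)

omit [Fintype F] [DecidableEq F] in
theorem jointRank_le (X₁ : Matrix (Fin m₁) (Fin T) F) (X₂ : Matrix (Fin m₂) (Fin T) F) :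
    jointRank X₁ X₂ ≤ finrank F (rowSpan X₁) + finrank F (rowSpan X₂) :=
  finrank_add_le_finrank_add_finrank _ _

/-- Block version of `matrixMAC_le_referenceLaw`. -/
theorem blockProb_le_referenceLaw {N m : ℕ} (X₁ : Fin N → Matrix (Fin m₁) (Fin T) F)
    (X₂ : Fin N → Matrix (Fin m₂) (Fin T) F) (V : Fin N → Submodule F (Fin T → F))
    (hV : ∀ t, V t ≤ rowSpan (X₁ t) ⊔ rowSpan (X₂ t))
    (hm : ∀ t, jointRank (X₁ t) (X₂ t) ≤ finrank F (V t) + m)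
    (y : Fin N → Matrix (Fin n) (Fin T) F) :
    blockProb (matrixMAC F n m₁ m₂ T) X₁ X₂ y ≤
      (∏ t, (2 ^ (n * m) * (Fintype.card F : ℝ) ^
        (min n (jointRank (X₁ t) (X₂ t) - finrank F (V t)) * (T - jointRank (X₁ t) (X₂ t)))))
        * ∏ t, referenceLaw n m (V t) (y t) := by
  rw [blockProb, ← Finset.prod_mul_distrib]
  exact Finset.prod_le_prod (fun _ _ => ENNReal.toReal_nonneg)
    fun t _ => matrixMAC_le_referenceLaw _ _ (hV t) (hm t) _

omit [DecidableEq F] in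
theorem sum_prod_referenceLaw_le {N : ℕ} (m : ℕ) (V : Fin N → Submodule F (Fin T → F)) :
    ∑ y : Fin N → Matrix (Fin n) (Fin T) F, ∏ t, referenceLaw n m (V t) (y t) ≤ 1 := by
  rw [← Fintype.piFinset_univ,
    Finset.sum_prod_piFinset Finset.univ fun t y => referenceLaw n m (V t) y]
  exact Finset.prod_le_one (fun t _ => Finset.sum_nonneg fun y _ => referenceLaw_nonneg _ _ _)
    fun t _ => sum_referenceLaw_le _ _

/-- Logarithms of the domination factors. -/
theorem lt_of_lt_prod_factor {N m : ℕ} {q : ℕ} (hq : 0 < q) (e : Fin N → ℕ) {M : ℝ} (hM : 0 < M)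
    (h : M / 4 < ∏ t : Fin N, (2 ^ (n * m) * (q : ℝ) ^ e t)) :
    Real.logb 2 M < 2 + N * (n * m) + ∑ t, e t * Real.logb 2 q := by
  have hq' : (q : ℝ) ≠ 0 := by positivity
  have h2 := Real.logb_lt_logb (b := 2) (by norm_num) (by positivity) h
  rw [Real.logb_prod Finset.univ _ fun t _ => by positivity,
    Real.logb_div hM.ne' (by norm_num)] at h2
  have h4 : Real.logb 2 4 = 2 := by
    rw [show (4 : ℝ) = 2 ^ (2 : ℕ) by norm_num, Real.logb_pow]
    simp
  rw [h4] at h2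
  have : ∀ t ∈ Finset.univ, Real.logb 2 (2 ^ (n * m) * (q : ℝ) ^ e t)
      = (n * m : ℝ) + e t * Real.logb 2 q := by
    intro t _
    rw [Real.logb_mul (by positivity) (by positivity), Real.logb_pow, Real.logb_pow]
    simp
  rw [Finset.sum_congr rfl this, Finset.sum_add_distrib] at h2
  simp only [Finset.sum_const, Finset.card_univ, Fintype.card_fin, nsmul_eq_mul] at h2
  linarith

/-- A code with small error probability has a sequence of pairs of inputs whose ranks bound the
numbers of messages. -/
theorem exists_inputs_of_errorProb_lt {N M₁ M₂ : ℕ}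
    (c : MACCode (Matrix (Fin m₁) (Fin T) F) (Matrix (Fin m₂) (Fin T) F)
      (Matrix (Fin n) (Fin T) F) N M₁ M₂) (h1 : 0 < M₁) (h2 : 0 < M₂)
    (herr : c.errorProb (matrixMAC F n m₁ m₂ T) < 1 / 4) :
    ∃ (X₁ : Fin N → Matrix (Fin m₁) (Fin T) F) (X₂ : Fin N → Matrix (Fin m₂) (Fin T) F),
      Real.logb 2 M₁ < 2 + N * (n * m₁) + ∑ t, (min n (jointRank (X₁ t) (X₂ t) -
        finrank F (rowSpan (X₂ t))) * (T - jointRank (X₁ t) (X₂ t)) : ℕ)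
          * Real.logb 2 (Fintype.card F) ∧
      Real.logb 2 M₂ < 2 + N * (n * m₂) + ∑ t, (min n (jointRank (X₁ t) (X₂ t) -
        finrank F (rowSpan (X₁ t))) * (T - jointRank (X₁ t) (X₂ t)) : ℕ)
          * Real.logb 2 (Fintype.card F) ∧
      Real.logb 2 M₁ + Real.logb 2 M₂ < 2 + N * (n * (m₁ + m₂)) + ∑ t,
        (min n (jointRank (X₁ t) (X₂ t)) * (T - jointRank (X₁ t) (X₂ t)) : ℕ)
          * Real.logb 2 (Fintype.card F) := by
  have hM1 : (0 : ℝ) < M₁ := by positivity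
  have hM2 : (0 : ℝ) < M₂ := by positivity
  obtain ⟨w₁, w₂, ha₁, ha₂, hb⟩ := exists_factors_of_errorProb_lt (matrixMAC F n m₁ m₂ T) c h1 h2
    (fun w y => ∏ t, referenceLaw n m₁ (rowSpan (c.enc₂ w t)) (y t))
    (fun w y => ∏ t, referenceLaw n m₂ (rowSpan (c.enc₁ w t)) (y t))
    (fun y => ∏ t, referenceLaw n (m₁ + m₂) (⊥ : Submodule F (Fin T → F)) (y t))
    (fun _ _ => Finset.prod_nonneg fun _ _ => referenceLaw_nonneg _ _ _)
    (fun _ _ => Finset.prod_nonneg fun _ _ => referenceLaw_nonneg _ _ _)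
    (fun _ => Finset.prod_nonneg fun _ _ => referenceLaw_nonneg _ _ _)
    (fun w => sum_prod_referenceLaw_le _ _) (fun w => sum_prod_referenceLaw_le _ _)
    (sum_prod_referenceLaw_le _ _) _ _ _
    (fun w₁ w₂ y => blockProb_le_referenceLaw _ _ _ (fun t => le_sup_right) (fun t => by
      have := jointRank_le (c.enc₁ w₁ t) (c.enc₂ w₂ t)
      have := finrank_rowSpan_le (c.enc₁ w₁ t)
      omega) y)
    (fun w₁ w₂ y => blockProb_le_referenceLaw _ _ _ (fun t => le_sup_left) (fun t => by
      have := jointRank_le (c.enc₁ w₁ t) (c.enc₂ w₂ t)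
      have := finrank_rowSpan_le (c.enc₂ w₂ t)
      omega) y)
    (fun w₁ w₂ y => blockProb_le_referenceLaw _ _ _ (fun t => bot_le) (fun t => by
      have := jointRank_le (c.enc₁ w₁ t) (c.enc₂ w₂ t)
      have := finrank_rowSpan_le (c.enc₂ w₂ t)
      have := finrank_rowSpan_le (c.enc₁ w₁ t)
      omega) y)
    herr
  refine ⟨c.enc₁ w₁, c.enc₂ w₂, lt_of_lt_prod_factor Fintype.card_pos _ hM1 ha₁,
    lt_of_lt_prod_factor Fintype.card_pos _ hM2 ha₂, ?_⟩
  have := lt_of_lt_prod_factor Fintype.card_pos _ (mul_pos hM1 hM2) hb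
  rw [Real.logb_mul hM1.ne' hM2.ne'] at this
  simpa using this

end Domination

/-! ### The outer bound: from rank sequences to the region -/

section OuterBound

variable {F : Type*} [Field F] [Fintype F] [DecidableEq F] {n m₁ m₂ T : ℕ}

/-- An average of points of the rectangles indexed by dimensions `u t`, `v t` lies in the
region. -/
theorem average_mem_asymptoticRegion {q N : ℕ} (hN : 0 < N) (u v r : Fin N → ℕ)
    (huv : ∀ t, (u t, v t) ∈ dimPairs n m₁ m₂) (hr : ∀ t, r t + (u t + v t) ≤ T) :
    ((∑ t, (u t * r t : ℕ) * Real.logb 2 q) / N, (∑ t, (v t * r t : ℕ) * Real.logb 2 q) / N)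
      ∈ asymptoticRegion q n m₁ m₂ T := by
  have hl := logb_card_nonneg q
  have hN' : (0 : ℝ) < N := by exact_mod_cast hN
  have h := (convex_asymptoticRegion q n m₁ m₂ T).sum_mem (t := Finset.univ)
    (w := fun _ : Fin N => (1 / N : ℝ))
    (z := fun t => (((u t * r t : ℕ) * Real.logb 2 q : ℝ), ((v t * r t : ℕ) * Real.logb 2 q : ℝ)))
    (fun _ _ => by positivity) (by simp [hN'.ne']) (fun t _ => by
      refine rateRectangle_subset_asymptoticRegion q T (huv t) ?_
      have h : ((r t + (u t + v t) : ℕ) : ℝ) ≤ T := by exact_mod_cast hr t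
      push_cast at h
      have h' : (r t : ℝ) ≤ T - u t - v t := by linarith
      refine ⟨⟨by positivity, ?_⟩, by positivity, ?_⟩ <;> push_cast <;> gcongr)
  convert h using 1
  rw [Prod.ext_iff]
  simp only [Prod.fst_sum, Prod.snd_sum, Prod.smul_fst, Prod.smul_snd, smul_eq_mul,
    ← Finset.mul_sum]
  constructor <;> ring

/-- A single long code with error below 1/4 suffices; η absorbs the two bits that come from the
factor 1/4. -/
theorem shifted_mem_asymptoticRegion (hT : m₁ + m₂ ≤ T) {R : ℝ × ℝ}
    (hR : IsAchievable (matrixMAC F n m₁ m₂ T) R) {η : ℝ} (hη : 0 < η) :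
    (max (R.1 - n * m₁ - η) 0, max (R.2 - n * m₂ - η) 0)
      ∈ asymptoticRegion (Fintype.card F) n m₁ m₂ T := by
  obtain ⟨-, -, hR⟩ := hR
  obtain ⟨N₀, hN₀⟩ := hR (1 / 5) (by norm_num)
  obtain ⟨N₁, hN₁⟩ := exists_nat_gt (2 / η)
  obtain ⟨M₁, M₂, c, hM₁, hM₂, herr⟩ := hN₀ (max N₀ (N₁ + 1)) (le_max_left _ _)
  have hNpos : 0 < max N₀ (N₁ + 1) := by omega
  have hNη : 2 ≤ (max N₀ (N₁ + 1) : ℕ) * η := by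
    rw [div_lt_iff₀ hη] at hN₁
    have : (N₁ : ℝ) ≤ (max N₀ (N₁ + 1) : ℕ) := by exact_mod_cast (by omega)
    nlinarith
  generalize max N₀ (N₁ + 1) = N at *
  have hM₁' : (0 : ℝ) < M₁ := lt_of_lt_of_le (by positivity) hM₁
  have hM₂' : (0 : ℝ) < M₂ := lt_of_lt_of_le (by positivity) hM₂
  obtain ⟨X₁, X₂, h1, h2, h3⟩ := exists_inputs_of_errorProb_lt c (by exact_mod_cast hM₁')
    (by exact_mod_cast hM₂') (by linarith)
  have l1 := (Real.le_logb_iff_rpow_le (by norm_num) hM₁').2 hM₁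
  have l2 := (Real.le_logb_iff_rpow_le (by norm_num) hM₂').2 hM₂
  set L := Real.logb 2 (Fintype.card F : ℝ) with hL
  have hl : 0 ≤ L := logb_card_nonneg _
  have hN : (0 : ℝ) < N := by exact_mod_cast hNpos
  set k : Fin N → ℕ := fun t => jointRank (X₁ t) (X₂ t)
  set d₁ : Fin N → ℕ := fun t => finrank F (rowSpan (X₁ t))
  set d₂ : Fin N → ℕ := fun t => finrank F (rowSpan (X₂ t))
  have hd₁ : ∀ t, d₁ t ≤ k t := fun t => finrank_mono le_sup_left
  have hd₂ : ∀ t, d₂ t ≤ k t := fun t => finrank_mono le_sup_right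
  have hk : ∀ t, k t ≤ d₁ t + d₂ t := fun t => jointRank_le _ _
  have hm₁ : ∀ t, d₁ t ≤ m₁ := fun t => finrank_rowSpan_le _
  have hm₂ : ∀ t, d₂ t ≤ m₂ := fun t => finrank_rowSpan_le _
  set b := (∑ t, (min n (k t) * (T - k t) : ℕ) * L) / N with hb
  set a₁ := (∑ t, (min n (k t - d₂ t) * (T - k t) : ℕ) * L) / N with ha₁
  set a₂ := (∑ t, (min n (k t - d₁ t) * (T - k t) : ℕ) * L) / N with ha₂
  -- In each use the corner belongs to dimensions u = min(n, k - d₂) and v = min(n, k) - u. Since u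
  -- + v ≤ k, the common factor T - k is at most T - u - v.
  have c1 : (a₁, b - a₁) ∈ asymptoticRegion (Fintype.card F) n m₁ m₂ T := by
    convert average_mem_asymptoticRegion (q := Fintype.card F) (n := n) (m₁ := m₁) (m₂ := m₂)
      (T := T) hNpos (fun t => min n (k t - d₂ t))
      (fun t => min n (k t) - min n (k t - d₂ t)) (fun t => T - k t) (fun t => ?_)
      (fun t => ?_) using 2
    · rw [hb, ha₁, ← sub_div, ← Finset.sum_sub_distrib]
      congr 1
      refine Finset.sum_congr rfl fun t _ => ?_
      rw [← sub_mul, Nat.sub_mul, Nat.cast_sub (Nat.mul_le_mul_right _ (by omega))]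
    · have := hd₁ t; have := hd₂ t; have := hk t; have := hm₁ t; have := hm₂ t
      refine ⟨?_, ?_, ?_⟩ <;> simp only <;> omega
    · have := hd₁ t; have := hd₂ t; have := hk t; have := hm₁ t; have := hm₂ t
      omega
  have c2 : (b - a₂, a₂) ∈ asymptoticRegion (Fintype.card F) n m₁ m₂ T := by
    convert average_mem_asymptoticRegion (q := Fintype.card F) (n := n) (m₁ := m₁) (m₂ := m₂)
      (T := T) hNpos (fun t => min n (k t) - min n (k t - d₁ t))
      (fun t => min n (k t - d₁ t)) (fun t => T - k t) (fun t => ?_)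
      (fun t => ?_) using 2
    · rw [hb, ha₂, ← sub_div, ← Finset.sum_sub_distrib]
      congr 1
      refine Finset.sum_congr rfl fun t _ => ?_
      rw [← sub_mul, Nat.sub_mul, Nat.cast_sub (Nat.mul_le_mul_right _ (by omega))]
    · have := hd₁ t; have := hd₂ t; have := hk t; have := hm₁ t; have := hm₂ t
      refine ⟨?_, ?_, ?_⟩ <;> simp only <;> omega
    · have := hd₁ t; have := hd₂ t; have := hk t; have := hm₁ t; have := hm₂ t
      omega
  have a₁0 : 0 ≤ a₁ := by positivity
  have a₂0 : 0 ≤ a₂ := by positivity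
  have a₁b : a₁ ≤ b := by
    refine div_le_div_of_nonneg_right (Finset.sum_le_sum fun t _ => ?_) hN.le
    gcongr
    omega
  have a₂b : a₂ ≤ b := by
    refine div_le_div_of_nonneg_right (Finset.sum_le_sum fun t _ => ?_) hN.le
    gcongr
    omega
  have e1 : R.1 - n * m₁ - η ≤ a₁ := by
    rw [ha₁, le_div_iff₀ hN]
    linarith
  have e2 : R.2 - n * m₂ - η ≤ a₂ := by
    rw [ha₂, le_div_iff₀ hN]
    linarith
  have e3 : (R.1 - n * m₁ - η) + (R.2 - n * m₂ - η) ≤ b := by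
    rw [hb, le_div_iff₀ hN]
    linarith
  refine pentagon_mem_asymptoticRegion (le_max_right _ _) (le_max_right _ _)
    (max_le e1 a₁0) (max_le e2 a₂0) ?_ c1 c2
  simp only
  rcases max_cases (R.1 - n * m₁ - η) 0 with h | h <;>
    rcases max_cases (R.2 - n * m₂ - η) 0 with h' | h' <;> linarith

/-- The outer bound on the capacity region. -/
theorem capacityRegion_subset (hT : m₁ + m₂ + 1 ≤ T) {ε : ℝ} (hε : 0 < ε)
    (hq : (2 * n * (m₁ + m₂) / ε : ℝ) ≤ Real.logb 2 (Fintype.card F)) :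
    capacityRegion (matrixMAC F n m₁ m₂ T)
      ⊆ (1 + ε) • asymptoticRegion (Fintype.card F) n m₁ m₂ T := by
  have hclosed := isClosed_asymptoticRegion (n := n) (m₁ := m₁) (m₂ := m₂) (T := T) (by omega)
    (Fintype.card F)
  refine closure_minimal (fun R hR => ?_) (hclosed.smul_of_ne_zero (by positivity))
  obtain ⟨z, hz, hze⟩ := exists_overhead_mem_asymptoticRegion hT hε hq
  have hP : (max (R.1 - n * m₁ - 0) 0, max (R.2 - n * m₂ - 0) 0)
      ∈ asymptoticRegion (Fintype.card F) n m₁ m₂ T := by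
    -- The case η = 0 is the limit η → 0⁺ in the closed region.
    have hcont : Continuous fun η : ℝ =>
        (max (R.1 - n * m₁ - η) 0, max (R.2 - n * m₂ - η) 0) := by fun_prop
    refine hclosed.mem_of_tendsto ((hcont.tendsto 0).mono_left nhdsWithin_le_nhds)
      (Filter.eventually_of_mem (self_mem_nhdsWithin (s := Set.Ioi 0)) fun η hη => ?_)
    exact shifted_mem_asymptoticRegion (by omega) hR hη
  rw [Prod.ext_iff] at hze
  simp only [Prod.smul_fst, Prod.smul_snd, smul_eq_mul] at hze
  refine mem_smul_asymptoticRegion hε hR.1 hR.2.1 hP hz ?_ ?_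
  · rw [← hze.1]
    linarith [le_max_left (R.1 - n * m₁ - 0) 0]
  · rw [← hze.2]
    linarith [le_max_left (R.2 - n * m₂ - 0) 0]

end OuterBound

/-! ### Random codes for erasures -/

section Erasure

/-- A message is confusable under the erasure pattern `E` when another codeword agrees with its
codeword outside the erased positions. -/
def Confusable {N M : ℕ} {S : Fin N → Type*} (enc : Fin M → ∀ t, S t) (E : Fin N → Bool)
    (w : Fin M) : Prop := ∃ w', w' ≠ w ∧ ∀ t, E t = false → enc w t = enc w' t

/-- The probability of an erasure pattern when position `t` is erased with probability `p t`. -/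
def patternProb {N : ℕ} (p : Fin N → ℝ) (E : Fin N → Bool) : ℝ :=
  ∏ t, if E t then p t else 1 - p t

theorem patternProb_nonneg {N : ℕ} {p : Fin N → ℝ} (h0 : ∀ t, 0 ≤ p t) (h1 : ∀ t, p t ≤ 1)
    (E : Fin N → Bool) : 0 ≤ patternProb p E :=
  Finset.prod_nonneg fun t _ => by
    have := h0 t
    have := h1 t
    split_ifs <;> linarith

/-- The average probability that a message is confusable. -/
noncomputable def erasureError {N M : ℕ} {S : Fin N → Type*} (p : Fin N → ℝ)
    (enc : Fin M → ∀ t, S t) : ℝ :=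
  open Classical in
  (∑ w, ∑ E, if Confusable enc E w then patternProb p E else 0) / M

/-- Two distinct codewords of a uniform codebook are independent: fixing every codeword but that of
`w` leaves c choices for it. -/
theorem card_filter_rel {ι X : Type*} [Fintype ι] [DecidableEq ι] [Fintype X]
    (r : X → X → Prop) [∀ x x', Decidable (r x x')] {c : ℕ}
    (hc : ∀ x', (Finset.univ.filter fun x => r x x').card = c) {w w' : ι} (hw : w' ≠ w) :
    (Finset.univ.filter fun f : ι → X => r (f w) (f w')).card * Fintype.card X
      = c * Fintype.card (ι → X) := by
  have e := Fintype.card_congr (Equiv.funSplitAt w X)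
  rw [Fintype.card_prod] at e
  have h : (Finset.univ.filter fun f : ι → X => r (f w) (f w')).card
      = c * Fintype.card ({j // j ≠ w} → X) := by
    have h1 : ∀ g : X × ({j // j ≠ w} → X),
        (Equiv.funSplitAt w X).symm g w = g.1 ∧ (Equiv.funSplitAt w X).symm g w' = g.2 ⟨w', hw⟩ := by
      intro g
      constructor
      · exact congrArg Prod.fst ((Equiv.funSplitAt w X).apply_symm_apply g)
      · exact congrFun (congrArg Prod.snd ((Equiv.funSplitAt w X).apply_symm_apply g)) ⟨w', hw⟩
    rw [Finset.card_filter, ← (Equiv.funSplitAt w X).symm.sum_comp]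
    simp only [h1]
    rw [Fintype.sum_prod_type_right]
    simp only [← Finset.card_filter, hc]
    rw [Finset.sum_const, smul_eq_mul, mul_comm, Finset.card_univ]
  rw [h, e]
  ring

theorem card_agree {N : ℕ} {S : Fin N → Type*} [∀ t, Fintype (S t)] [∀ t, DecidableEq (S t)]
    (E : Fin N → Bool) (x' : ∀ t, S t) :
    (Finset.univ.filter fun x : ∀ t, S t => ∀ t, E t = false → x t = x' t).card
      = ∏ t, if E t then Fintype.card (S t) else 1 := by
  have h : (Finset.univ.filter fun x : ∀ t, S t => ∀ t, E t = false → x t = x' t)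
      = Fintype.piFinset fun t => if E t then Finset.univ else {x' t} := by
    ext x
    simp only [Finset.mem_filter_univ, Fintype.mem_piFinset]
    refine forall_congr' fun t => ?_
    cases E t <;> simp
  rw [h, Fintype.card_piFinset]
  refine Finset.prod_congr rfl fun t _ => ?_
  split_ifs <;> simp

/-- Gallager's device: a probability is at most any power ρ ∈ [0, 1] of its union bound. -/
theorem le_rpow_of_le_of_le_one {a x ρ : ℝ} (hx : 0 ≤ x) (ha : a ≤ x) (ha1 : a ≤ 1) (h0 : 0 ≤ ρ)
    (h1 : ρ ≤ 1) : a ≤ x ^ ρ := by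
  rcases le_total x 1 with h | h
  · exact ha.trans (Real.self_le_rpow_of_le_one hx h h1)
  · exact ha1.trans (Real.one_le_rpow h h0)

/-- The number of codebooks for which a message is confusable. -/
theorem card_confusable_le {N M : ℕ} {S : Fin N → Type*} [∀ t, Fintype (S t)]
    [∀ t, Nonempty (S t)] (E : Fin N → Bool) (w : Fin M) {ρ : ℝ} (h0 : 0 ≤ ρ) (h1 : ρ ≤ 1) :
    open Classical in
    ((Finset.univ.filter fun enc : Fin M → ∀ t, S t => Confusable enc E w).card : ℝ)
      ≤ (((M : ℝ) - 1) * ∏ t, if E t then 1 else (Fintype.card (S t) : ℝ)⁻¹) ^ ρ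
        * Fintype.card (Fin M → ∀ t, S t) := by
  classical
  have hM : (1 : ℝ) ≤ M := by exact_mod_cast w.pos
  have hX : (0 : ℝ) < Fintype.card (Fin M → ∀ t, S t) := by exact_mod_cast Fintype.card_pos
  set X := Fintype.card (Fin M → ∀ t, S t)
  set π : ℝ := ∏ t, if E t then 1 else (Fintype.card (S t) : ℝ)⁻¹ with hπ
  have hπ0 : 0 ≤ π := Finset.prod_nonneg fun t _ => by split_ifs <;> positivity
  have hpair : ∀ w', w' ≠ w → ((Finset.univ.filter fun enc : Fin M → ∀ t, S t =>
      ∀ t, E t = false → enc w t = enc w' t).card : ℝ) = π * X := by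
    intro w' hw
    have h := card_filter_rel (ι := Fin M) (X := ∀ t, S t)
      (fun x x' => ∀ t, E t = false → x t = x' t) (card_agree E) hw
    have hS : (0 : ℝ) < Fintype.card (∀ t, S t) := by exact_mod_cast Fintype.card_pos
    have h' := congrArg (Nat.cast : ℕ → ℝ) h
    rw [Nat.cast_mul, Nat.cast_mul, ← eq_div_iff hS.ne'] at h'
    rw [h', mul_div_right_comm]
    congr 1
    rw [div_eq_iff hS.ne', hπ, Fintype.card_pi, Nat.cast_prod, Nat.cast_prod,
      ← Finset.prod_mul_distrib]
    refine Finset.prod_congr rfl fun t _ => ?_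
    have : (Fintype.card (S t) : ℝ) ≠ 0 := by exact_mod_cast Fintype.card_ne_zero
    split_ifs <;> simp [this]
  rw [← div_le_iff₀ hX]
  refine le_rpow_of_le_of_le_one (by nlinarith) ?_ ?_ h0 h1
  · rw [div_le_iff₀ hX]
    have hsub : (Finset.univ.filter fun enc : Fin M → ∀ t, S t => Confusable enc E w)
        ⊆ (Finset.univ.erase w).biUnion fun w' => Finset.univ.filter fun enc : Fin M → ∀ t, S t =>
          ∀ t, E t = false → enc w t = enc w' t := by
      intro enc henc
      obtain ⟨w', hw', h⟩ := (Finset.mem_filter.1 henc).2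
      exact Finset.mem_biUnion.2 ⟨w', Finset.mem_erase.2 ⟨hw', Finset.mem_univ _⟩,
        Finset.mem_filter.2 ⟨Finset.mem_univ _, h⟩⟩
    have h := (Finset.card_le_card hsub).trans Finset.card_biUnion_le
    have h' : ((Finset.univ.filter fun enc : Fin M → ∀ t, S t => Confusable enc E w).card : ℝ)
        ≤ ∑ w' ∈ Finset.univ.erase w, ((Finset.univ.filter fun enc : Fin M → ∀ t, S t =>
          ∀ t, E t = false → enc w t = enc w' t).card : ℝ) := by exact_mod_cast h
    rw [Finset.sum_congr rfl fun w' hw' => hpair w' (Finset.mem_erase.1 hw').1, Finset.sum_const,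
      Finset.card_erase_of_mem (Finset.mem_univ _), Finset.card_univ, Fintype.card_fin,
      nsmul_eq_mul, Nat.cast_sub w.pos] at h'
    simpa [mul_assoc] using h'
  · exact div_le_one_of_le₀ (by exact_mod_cast Finset.card_le_univ _) hX.le

/-- There is a codebook whose average confusion probability obeys the random coding bound. -/
theorem exists_erasureError_le {N M : ℕ} (hM : 0 < M) (S : Fin N → Type*) [∀ t, Fintype (S t)]
    [∀ t, Nonempty (S t)] {p : Fin N → ℝ} (hp0 : ∀ t, 0 ≤ p t) (hp1 : ∀ t, p t ≤ 1) {ρ : ℝ}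
    (h0 : 0 ≤ ρ) (h1 : ρ ≤ 1) :
    ∃ enc : Fin M → ∀ t, S t, erasureError p enc
      ≤ ((M : ℝ) - 1) ^ ρ * ∏ t, (p t + (1 - p t) * ((Fintype.card (S t) : ℝ)⁻¹) ^ ρ) := by
  classical
  set K : ℝ := ((M : ℝ) - 1) ^ ρ * ∏ t, (p t + (1 - p t) * ((Fintype.card (S t) : ℝ)⁻¹) ^ ρ) with hK
  have hM' : (0 : ℝ) < M := by exact_mod_cast hM
  have hM1 : (0 : ℝ) ≤ (M : ℝ) - 1 := by
    have : (1 : ℝ) ≤ M := by exact_mod_cast hM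
    linarith
  -- The average over erasure patterns factors over the positions.
  have hKE : ∑ E, patternProb p E *
      (((M : ℝ) - 1) * ∏ t, if E t then 1 else (Fintype.card (S t) : ℝ)⁻¹) ^ ρ = K := by
    have h : ∀ E : Fin N → Bool, patternProb p E *
        (((M : ℝ) - 1) * ∏ t, if E t then 1 else (Fintype.card (S t) : ℝ)⁻¹) ^ ρ
        = ((M : ℝ) - 1) ^ ρ *
          ∏ t, (if E t then p t else (1 - p t) * ((Fintype.card (S t) : ℝ)⁻¹) ^ ρ) := by
      intro E
      rw [Real.mul_rpow hM1 (Finset.prod_nonneg fun t _ => by split_ifs <;> positivity),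
        ← Real.finsetProd_rpow _ _ fun t _ => by split_ifs <;> positivity, patternProb,
        mul_left_comm, ← Finset.prod_mul_distrib]
      congr 1
      refine Finset.prod_congr rfl fun t _ => ?_
      split_ifs <;> simp
    simp only [h]
    rw [← Finset.mul_sum, hK, ← Fintype.piFinset_univ, Finset.sum_prod_piFinset Finset.univ
      fun t (b : Bool) => if b then p t else (1 - p t) * ((Fintype.card (S t) : ℝ)⁻¹) ^ ρ]
    simp
  have hsum : ∑ enc : Fin M → ∀ t, S t, erasureError p enc
      ≤ ∑ _enc : Fin M → ∀ t, S t, K := by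
    simp only [erasureError]
    rw [← Finset.sum_div, div_le_iff₀ hM', Finset.sum_comm]
    have hw : ∀ w : Fin M, ∑ enc : Fin M → ∀ t, S t, ∑ E,
        (if Confusable enc E w then patternProb p E else 0)
        ≤ K * Fintype.card (Fin M → ∀ t, S t) := by
      intro w
      rw [Finset.sum_comm, ← hKE, Finset.sum_mul]
      refine Finset.sum_le_sum fun E _ => ?_
      rw [← Finset.sum_filter, Finset.sum_const, nsmul_eq_mul, mul_comm, mul_assoc]
      exact mul_le_mul_of_nonneg_left (card_confusable_le E w h0 h1)
        (patternProb_nonneg hp0 hp1 E)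
    refine (Finset.sum_le_sum fun w _ => hw w).trans (le_of_eq ?_)
    simp only [Finset.sum_const, Finset.card_univ, Fintype.card_fin, nsmul_eq_mul]
    ring
  obtain ⟨enc, -, h⟩ := Finset.exists_le_of_sum_le Finset.univ_nonempty hsum
  exact ⟨enc, h⟩

/-- The law of the erasure pattern of a block of outputs. -/
theorem sum_prod_mul_pattern {N : ℕ} {C : Type*} [Fintype C] (P : Fin N → PMF C)
    (bad : Fin N → C → Bool) {p : Fin N → ℝ}
    (hp : ∀ t, ∑ y, (if bad t y then (P t y).toReal else 0) = p t) (g : (Fin N → Bool) → ℝ) :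
    ∑ y : Fin N → C, (∏ t, (P t (y t)).toReal) * g (fun t => bad t (y t))
      = ∑ E, patternProb p E * g E := by
  classical
  have hE : ∀ E : Fin N → Bool, patternProb p E
      = ∑ y : Fin N → C, if (fun t => bad t (y t)) = E then ∏ t, (P t (y t)).toReal else 0 := by
    intro E
    have h1 : ∀ t, (if E t then p t else 1 - p t)
        = ∑ y, if bad t y = E t then (P t y).toReal else 0 := by
      intro t
      cases hEt : E t
      · simp only [Bool.false_eq_true, if_false]
        rw [← hp t, ← sum_pmf_toReal (P t), ← Finset.sum_sub_distrib]
        refine Finset.sum_congr rfl fun y _ => ?_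
        cases bad t y <;> simp
      · simp only [if_true]
        exact (hp t).symm
    rw [patternProb, Finset.prod_congr rfl fun t _ => h1 t,
      ← Finset.sum_prod_piFinset Finset.univ
        fun t y => if bad t y = E t then (P t y).toReal else 0, Fintype.piFinset_univ]
    refine Finset.sum_congr rfl fun y _ => ?_
    rw [Finset.prod_ite_zero]
    simp [funext_iff]
  simp only [hE, Finset.sum_mul]
  rw [Finset.sum_comm]
  refine Finset.sum_congr rfl fun y _ => ?_
  simp [ite_mul]

/-- If the unerased outputs determine the inputs, then two encoders can be combined into a code
whose error probability is at most the sum of their confusion probabilities. -/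
theorem exists_code_errorProb_le {A B C : Type*} [Fintype C] (W : A → B → PMF C) {N M₁ M₂ : ℕ}
    (hM₁ : 0 < M₁) (hM₂ : 0 < M₂) {S₁ S₂ : Fin N → Type*} (φ₁ : ∀ t, S₁ t → A)
    (φ₂ : ∀ t, S₂ t → B) (bad : Fin N → C → Bool) {p : Fin N → ℝ}
    (hp : ∀ t s₁ s₂, ∑ y, (if bad t y then (W (φ₁ t s₁) (φ₂ t s₂) y).toReal else 0) = p t)
    (hinj : ∀ t s₁ s₂ s₁' s₂' y, bad t y = false → (W (φ₁ t s₁) (φ₂ t s₂) y).toReal ≠ 0 →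
      (W (φ₁ t s₁') (φ₂ t s₂') y).toReal ≠ 0 → s₁ = s₁' ∧ s₂ = s₂')
    (enc₁ : Fin M₁ → ∀ t, S₁ t) (enc₂ : Fin M₂ → ∀ t, S₂ t) :
    ∃ c : MACCode A B C N M₁ M₂, c.errorProb W ≤ erasureError p enc₁ + erasureError p enc₂ := by
  classical
  let consistent : (Fin N → C) → Fin M₁ × Fin M₂ → Prop := fun y w =>
    ∀ t, (W (φ₁ t (enc₁ w.1 t)) (φ₂ t (enc₂ w.2 t)) (y t)).toReal ≠ 0
  let c : MACCode A B C N M₁ M₂ :=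
    { enc₁ := fun w t => φ₁ t (enc₁ w t)
      enc₂ := fun w t => φ₂ t (enc₂ w t)
      -- Any message pair that could have produced y will do; the default pair is irrelevant, since
      -- the true pair is almost surely consistent.
      dec := fun y => if h : ∃ w, consistent y w then h.choose else (⟨0, hM₁⟩, ⟨0, hM₂⟩) }
  have hM1 : (0 : ℝ) < M₁ := by exact_mod_cast hM₁
  have hM2 : (0 : ℝ) < M₂ := by exact_mod_cast hM₂
  refine ⟨c, ?_⟩
  have hpt : ∀ w y, (if c.dec y = w then 0 else blockProb W (c.enc₁ w.1) (c.enc₂ w.2) y)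
      ≤ (∏ t, (W (φ₁ t (enc₁ w.1 t)) (φ₂ t (enc₂ w.2 t)) (y t)).toReal) *
        ((if Confusable enc₁ (fun t => bad t (y t)) w.1 then 1 else 0) +
          (if Confusable enc₂ (fun t => bad t (y t)) w.2 then 1 else 0)) := by
    intro w y
    have hnn := blockProb_nonneg W (c.enc₁ w.1) (c.enc₂ w.2) y
    change _ ≤ blockProb W (c.enc₁ w.1) (c.enc₂ w.2) y * _
    by_cases hdec : c.dec y = w
    · rw [if_pos hdec]
      exact mul_nonneg hnn (add_nonneg (by split_ifs <;> norm_num) (by split_ifs <;> norm_num))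
    rw [if_neg hdec]
    by_cases h1 : Confusable enc₁ (fun t => bad t (y t)) w.1
    · rw [if_pos h1]
      split_ifs <;> linarith
    by_cases h2 : Confusable enc₂ (fun t => bad t (y t)) w.2
    · rw [if_neg h1, if_pos h2]
      linarith
    · rw [if_neg h1, if_neg h2, add_zero, mul_zero]
      refine le_of_not_gt fun hpos => ?_
      have hw : consistent y w := fun t =>
        (Finset.prod_ne_zero_iff.1 hpos.ne') t (Finset.mem_univ t)
      have hex : ∃ w, consistent y w := ⟨w, hw⟩
      have hd : c.dec y = hex.choose := dif_pos hex
      have hd' : consistent y (c.dec y) := hd ▸ hex.choose_spec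
      have hagree : ∀ t, bad t (y t) = false →
          enc₁ w.1 t = enc₁ (c.dec y).1 t ∧ enc₂ w.2 t = enc₂ (c.dec y).2 t :=
        fun t ht => hinj t _ _ _ _ _ ht (hw t) (hd' t)
      -- The decoded and the true pair agree in both codewords at unerased positions, so a wrong
      -- component witnesses confusability.
      by_cases e1 : (c.dec y).1 = w.1
      · refine h2 ⟨(c.dec y).2, fun e2 => hdec (Prod.ext e1 e2), fun t ht => (hagree t ht).2⟩
      · exact h1 ⟨(c.dec y).1, e1, fun t ht => (hagree t ht).1⟩
  let f₁ : Fin M₁ → ℝ := fun w => ∑ E, if Confusable enc₁ E w then patternProb p E else 0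
  let f₂ : Fin M₂ → ℝ := fun w => ∑ E, if Confusable enc₂ E w then patternProb p E else 0
  have hw : ∀ w : Fin M₁ × Fin M₂, ∑ y : Fin N → C,
      (if c.dec y = w then 0 else blockProb W (c.enc₁ w.1) (c.enc₂ w.2) y)
      ≤ f₁ w.1 + f₂ w.2 := by
    intro w
    refine (Finset.sum_le_sum fun y _ => hpt w y).trans (le_of_eq ?_)
    rw [sum_prod_mul_pattern (fun t => W (φ₁ t (enc₁ w.1 t)) (φ₂ t (enc₂ w.2 t))) bad
      (fun t => hp t _ _) fun E => (if Confusable enc₁ E w.1 then 1 else 0) +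
          (if Confusable enc₂ E w.2 then 1 else 0)]
    simp [f₁, f₂, mul_add, Finset.sum_add_distrib]
  rw [MACCode.errorProb, div_le_iff₀ (by positivity)]
  refine (Finset.sum_le_sum fun w _ => hw w).trans (le_of_eq ?_)
  rw [Finset.sum_add_distrib, Fintype.sum_prod_type, Fintype.sum_prod_type]
  simp only [Finset.sum_const, Finset.card_univ, Fintype.card_fin, nsmul_eq_mul, ← Finset.mul_sum]
  change _ = ((∑ w, f₁ w) / M₁ + (∑ w, f₂ w) / M₂) * (M₁ * M₂)
  field_simp

end Erasure

/-! ### The coding scheme over one channel use -/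

/-- Equal fibres again; it makes the selected columns of (G₁, G₂) uniform. -/
theorem sum_comp_div_card_of_surjective {G H : Type*} [AddGroup G] [Fintype G] [AddGroup H]
    [Fintype H] (f : G →+ H) (hf : Function.Surjective f) (g : H → ℝ) :
    (∑ a, g (f a)) / Fintype.card G = (∑ y, g y) / Fintype.card H := by
  classical
  rw [← sum_map_uniform f g, Finset.sum_div]
  refine Finset.sum_congr rfl fun y _ => ?_
  have h := card_fiber_mul_card_range f (y := y) (hf y)
  have hr : Nat.card f.range = Fintype.card H := by
    rw [AddMonoidHom.range_eq_top.2 hf, Nat.card_congr (AddSubgroup.topEquiv (G := H)).toEquiv,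
      Nat.card_eq_fintype_card]
  rw [hr] at h
  have hH : (Fintype.card H : ℝ) ≠ 0 := by exact_mod_cast Fintype.card_ne_zero
  have hfib : ((Finset.univ.filter fun a => f a = y).card : ℝ) ≠ 0 := by
    intro h0
    rw [Nat.cast_eq_zero] at h0
    rw [h0, zero_mul] at h
    exact Fintype.card_ne_zero h.symm
  rw [map_uniform_toReal, ← h]
  push_cast
  rw [div_mul_cancel_left₀ hfib]
  ring

section Scheme

variable {F : Type*} [Field F] [Fintype F] [DecidableEq F] {n m₁ m₂ T : ℕ}

omit [DecidableEq F] in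
open Classical in
/-- Few families of at most `n` vectors of `F ^ n` are linearly dependent. -/
theorem card_dependent_div_le {d₁ d₂ : ℕ} (hd : d₁ + d₂ ≤ n) :
    (∑ v : Fin d₁ ⊕ Fin d₂ → Fin n → F, if LinearIndependent F v then (0 : ℝ) else 1)
      / Fintype.card (Fin d₁ ⊕ Fin d₂ → Fin n → F) ≤ n / Fintype.card F := by
  set q := Fintype.card F with hqdef
  have hq1 : 1 ≤ q := Fintype.card_pos
  have hq : (1 : ℝ) ≤ q := by exact_mod_cast hq1
  have hq0 : (0 : ℝ) < q := by linarith
  have hcard : Fintype.card (Fin d₁ ⊕ Fin d₂ → Fin n → F) = (q ^ n) ^ (d₁ + d₂) := by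
    simp [hqdef]
  have hind : (∑ v : Fin d₁ ⊕ Fin d₂ → Fin n → F, if LinearIndependent F v then (1 : ℝ) else 0)
      = ∏ i : Fin (d₁ + d₂), ((q : ℝ) ^ n - q ^ i.val) := by
    have h := card_linearIndependent (K := F) (V := Fin n → F) (k := d₁ + d₂) (by simpa using hd)
    have e : {v : Fin d₁ ⊕ Fin d₂ → Fin n → F // LinearIndependent F v}
        ≃ {s : Fin (d₁ + d₂) → Fin n → F // LinearIndependent F s} :=
      Equiv.subtypeEquiv (Equiv.arrowCongr finSumFinEquiv (Equiv.refl _)) fun v => by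
        exact (linearIndependent_equiv finSumFinEquiv.symm).symm
    rw [← Nat.card_congr e, Nat.card_eq_fintype_card, Fintype.card_subtype] at h
    rw [Finset.sum_boole, h, Nat.cast_prod]
    refine Finset.prod_congr rfl fun i _ => ?_
    have hi := i.2
    rw [Module.finrank_fintype_fun_eq_card, Fintype.card_fin,
      Nat.cast_sub (Nat.pow_le_pow_right hq1 (by omega))]
    push_cast
    rfl
  -- Each factor is at least q ^ n (1 - 1/q); Bernoulli's inequality and d₁ + d₂ ≤ n do the rest.
  have hlow : ((q : ℝ) ^ n) ^ (d₁ + d₂) * (1 - n / q)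
      ≤ ∏ i : Fin (d₁ + d₂), ((q : ℝ) ^ n - q ^ i.val) := by
    have h1 : ∏ _i : Fin (d₁ + d₂), ((q : ℝ) ^ n * (1 - 1 / q))
        ≤ ∏ i : Fin (d₁ + d₂), ((q : ℝ) ^ n - q ^ i.val) := by
      refine Finset.prod_le_prod (fun i _ => ?_) fun i _ => ?_
      · have : 1 / (q : ℝ) ≤ 1 := by rw [div_le_one hq0]; exact hq
        exact mul_nonneg (by positivity) (by linarith)
      · have hi := i.2
        have e1 : (q : ℝ) ^ n * (1 - 1 / q) = (q : ℝ) ^ n - q ^ (n - 1) := by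
          obtain ⟨k, rfl⟩ : ∃ k, n = k + 1 := ⟨n - 1, by omega⟩
          rw [Nat.add_sub_cancel, pow_succ]
          field_simp
        rw [e1]
        have : (q : ℝ) ^ i.val ≤ (q : ℝ) ^ (n - 1) := pow_le_pow_right₀ hq (by omega)
        linarith
    refine le_trans ?_ h1
    rw [Finset.prod_const, Finset.card_univ, Fintype.card_fin, mul_pow]
    refine mul_le_mul_of_nonneg_left ?_ (by positivity)
    have h2 := one_add_mul_le_pow (a := -(1 / (q : ℝ))) (by
      have : 1 / (q : ℝ) ≤ 1 := by rw [div_le_one hq0]; exact hq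
      linarith) (d₁ + d₂)
    rw [← sub_eq_add_neg] at h2
    refine le_trans ?_ h2
    have : ((d₁ + d₂ : ℕ) : ℝ) ≤ n := by exact_mod_cast hd
    have h3 : ((d₁ + d₂ : ℕ) : ℝ) / q ≤ n / q := by gcongr
    have h4 : ((d₁ + d₂ : ℕ) : ℝ) * -(1 / (q : ℝ)) = -(((d₁ + d₂ : ℕ) : ℝ) / q) := by ring
    linarith
  have hsplit : (∑ v : Fin d₁ ⊕ Fin d₂ → Fin n → F, if LinearIndependent F v then (0 : ℝ) else 1)
      = ((q : ℝ) ^ n) ^ (d₁ + d₂) - ∏ i : Fin (d₁ + d₂), ((q : ℝ) ^ n - q ^ i.val) := by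
    rw [← hind, eq_sub_iff_add_eq, ← Finset.sum_add_distrib,
      Finset.sum_congr rfl (g := fun _ => (1 : ℝ)) fun v _ => by split_ifs <;> simp]
    rw [Finset.sum_const, Finset.card_univ, hcard]
    simp
  rw [hsplit, hcard, div_le_iff₀ (by positivity)]
  push_cast
  linarith

/-- Pad a matrix with zero rows. -/
def padRows {d m : ℕ} (h : d ≤ m) (B : Fin d → Fin T → F) : Matrix (Fin m) (Fin T) F :=
  fun a c => ∑ i, if Fin.castLE h i = a then B i c else 0

omit [Fintype F] [DecidableEq F] in
theorem mul_padRows_apply {d m : ℕ} (h : d ≤ m) (B : Fin d → Fin T → F)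
    (G : Matrix (Fin n) (Fin m) F) (a : Fin n) (c : Fin T) :
    (G * padRows h B) a c = ∑ i, G a (Fin.castLE h i) * B i c := by
  simp only [Matrix.mul_apply, padRows, Finset.mul_sum]
  rw [Finset.sum_comm]
  simp

/-- When the sources send matrices with complementary identity blocks, an output whose
corresponding columns are independent determines the inputs; this fails with small probability,
whatever the inputs are. -/
theorem exists_erasure_scheme {d₁ d₂ : ℕ} (h₁ : d₁ ≤ m₁) (h₂ : d₂ ≤ m₂) (hn : d₁ + d₂ ≤ n)
    (hT : d₁ + d₂ ≤ T) :
    ∃ (φ₁ : (Fin d₁ → Fin (T - d₁ - d₂) → F) → Matrix (Fin m₁) (Fin T) F)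
      (φ₂ : (Fin d₂ → Fin (T - d₁ - d₂) → F) → Matrix (Fin m₂) (Fin T) F)
      (bad : Matrix (Fin n) (Fin T) F → Bool) (p : ℝ),
      0 ≤ p ∧ p ≤ 1 ∧ p ≤ n / Fintype.card F ∧
      (∀ s₁ s₂, ∑ y, (if bad y then (matrixMAC F n m₁ m₂ T (φ₁ s₁) (φ₂ s₂) y).toReal else 0) = p) ∧
      (∀ s₁ s₂ s₁' s₂' y, bad y = false →
        (matrixMAC F n m₁ m₂ T (φ₁ s₁) (φ₂ s₂) y).toReal ≠ 0 →
        (matrixMAC F n m₁ m₂ T (φ₁ s₁') (φ₂ s₂') y).toReal ≠ 0 → s₁ = s₁' ∧ s₂ = s₂') := by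
  classical
  have hcard : Fintype.card (Fin d₁ ⊕ (Fin d₂ ⊕ Fin (T - d₁ - d₂))) = Fintype.card (Fin T) := by
    simp only [Fintype.card_sum, Fintype.card_fin]
    omega
  -- `e` splits the T columns into two identity blocks and a data block.
  let e := Fintype.equivOfCardEq hcard
  let φ₁ : (Fin d₁ → Fin (T - d₁ - d₂) → F) → Matrix (Fin m₁) (Fin T) F := fun s =>
    padRows h₁ fun i c => Sum.elim (fun i' => if i = i' then 1 else 0) (Sum.elim 0 (s i)) (e.symm c)
  let φ₂ : (Fin d₂ → Fin (T - d₁ - d₂) → F) → Matrix (Fin m₂) (Fin T) F := fun s =>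
    padRows h₂ fun i c => Sum.elim 0 (Sum.elim (fun i' => if i = i' then 1 else 0) (s i)) (e.symm c)
  let cols : (Matrix (Fin n) (Fin m₁) F × Matrix (Fin n) (Fin m₂) F) →+
      (Fin d₁ ⊕ Fin d₂ → Fin n → F) :=
    { toFun := fun G => Sum.elim (fun i a => G.1 a (Fin.castLE h₁ i))
        fun i a => G.2 a (Fin.castLE h₂ i)
      map_zero' := by ext (i | i) a <;> rfl
      map_add' := fun G G' => by ext (i | i) a <;> rfl }
  let head : Matrix (Fin n) (Fin T) F → Fin d₁ ⊕ Fin d₂ → Fin n → F := fun y =>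
    Sum.elim (fun i a => y a (e (Sum.inl i))) fun i a => y a (e (Sum.inr (Sum.inl i)))
  have hhead : ∀ G s₁ s₂, head (G.1 * φ₁ s₁ + G.2 * φ₂ s₂) = cols G := by
    intro G s₁ s₂
    ext (i | i) a
    · simp [head, cols, φ₁, φ₂, Matrix.add_apply, mul_padRows_apply]
    · simp [head, cols, φ₁, φ₂, Matrix.add_apply, mul_padRows_apply]
  have htail : ∀ G s₁ s₂ a j, (G.1 * φ₁ s₁ + G.2 * φ₂ s₂) a (e (Sum.inr (Sum.inr j)))
      = ∑ i, Sum.elim (fun i => s₁ i j) (fun i => s₂ i j) i * cols G i a := by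
    intro G s₁ s₂ a j
    simp [cols, φ₁, φ₂, Matrix.add_apply, mul_padRows_apply, mul_comm]
  let g : (Fin d₁ ⊕ Fin d₂ → Fin n → F) → ℝ := fun v => if LinearIndependent F v then 0 else 1
  have hsurj : Function.Surjective cols := by
    intro v
    refine ⟨(fun a b => if h : b.val < d₁ then v (Sum.inl ⟨b.val, h⟩) a else 0,
      fun a b => if h : b.val < d₂ then v (Sum.inr ⟨b.val, h⟩) a else 0), ?_⟩
    ext (i | i) a <;> simp [cols]
  refine ⟨φ₁, φ₂, fun y => decide (¬ LinearIndependent F (head y)),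
    (∑ G, g (cols G)) / Fintype.card (Matrix (Fin n) (Fin m₁) F × Matrix (Fin n) (Fin m₂) F),
    ?_, ?_, ?_, ?_, ?_⟩
  · refine div_nonneg (Finset.sum_nonneg fun G _ => ?_) (by positivity)
    simp only [g]
    split_ifs <;> norm_num
  · refine div_le_one_of_le₀ ?_ (by positivity)
    rw [← Finset.card_univ, ← nsmul_one]
    refine Finset.sum_le_card_nsmul _ _ _ fun G _ => ?_
    simp only [g]
    split_ifs <;> norm_num
  · rw [sum_comp_div_card_of_surjective cols hsurj g]
    exact card_dependent_div_le hn
  · intro s₁ s₂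
    have h := sum_map_uniform (fun G : Matrix (Fin n) (Fin m₁) F × Matrix (Fin n) (Fin m₂) F =>
      G.1 * φ₁ s₁ + G.2 * φ₂ s₂) fun y => g (head y)
    simp only [hhead] at h
    rw [← h]
    refine Finset.sum_congr rfl fun y _ => ?_
    by_cases hy : LinearIndependent F (head y) <;> simp [hy, g, matrixMAC]
  · intro s₁ s₂ s₁' s₂' y hy hW hW'
    have hli : LinearIndependent F (head y) := by simpa using hy
    have hex : ∀ s₁ s₂, (matrixMAC F n m₁ m₂ T (φ₁ s₁) (φ₂ s₂) y).toReal ≠ 0 → ∀ a j,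
        y a (e (Sum.inr (Sum.inr j)))
          = ∑ i, Sum.elim (fun i => s₁ i j) (fun i => s₂ i j) i * head y i a := by
      intro s₁ s₂ h a j
      rw [matrixMAC, map_uniform_toReal] at h
      have hne : (Finset.univ.filter fun G : Matrix (Fin n) (Fin m₁) F × Matrix (Fin n) (Fin m₂) F =>
          G.1 * φ₁ s₁ + G.2 * φ₂ s₂ = y).Nonempty := by
        rw [Finset.nonempty_iff_ne_empty]
        intro h0
        simp [h0] at h
      obtain ⟨G, hG⟩ := hne
      rw [← (Finset.mem_filter.1 hG).2, hhead]
      exact htail G s₁ s₂ a j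
    have key : ∀ j, Sum.elim (fun i => s₁ i j) (fun i => s₂ i j)
        = Sum.elim (fun i => s₁' i j) (fun i => s₂' i j) := by
      intro j
      -- Each data column of y is a combination of the head columns with coefficients from the
      -- inputs; independence makes the coefficients unique.
      refine (linearIndependent_iff_injective_fintypeLinearCombination.1 hli) ?_
      ext a
      simp only [Fintype.linearCombination_apply, Finset.sum_apply, Pi.smul_apply, smul_eq_mul]
      rw [← hex s₁ s₂ hW a j, ← hex s₁' s₂' hW' a j]
    constructor
    · ext i j
      exact congrFun (key j) (Sum.inl i)
    · ext i j
      exact congrFun (key j) (Sum.inr i)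

end Scheme

/-! ### The inner bound: time sharing and error exponents -/

section InnerBound

/-- Time sharing: positions of a block can be assigned to modes in given proportions, up to a
bounded loss. -/
theorem exists_assignment {ι : Type*} [Fintype ι] {w : ι → ℝ} (h0 : ∀ j, 0 ≤ w j)
    (h1 : ∑ j, w j = 1) (N : ℕ) :
    ∃ τ : Fin N → ι, ∀ f : ι → ℕ,
      N * (∑ j, w j * f j) - ∑ j, (f j : ℝ) ≤ ∑ t, (f (τ t) : ℝ) := by
  classical
  have hne : Nonempty ι := by
    by_contra h
    rw [not_nonempty_iff] at h
    simp at h1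
  -- Mode j receives ⌊w j * N⌋ positions and the leftovers are arbitrary, so each mode loses at most
  -- one position.
  have hcard : Fintype.card (Σ j, Fin ⌊w j * N⌋₊) ≤ Fintype.card (Fin N) := by
    rw [Fintype.card_sigma, Fintype.card_fin]
    simp only [Fintype.card_fin]
    have : ((∑ j, ⌊w j * N⌋₊ : ℕ) : ℝ) ≤ N := by
      push_cast
      calc ∑ j, (⌊w j * N⌋₊ : ℝ) ≤ ∑ j, w j * N :=
            Finset.sum_le_sum fun j _ => Nat.floor_le (by have := h0 j; positivity)
        _ = N := by rw [← Finset.sum_mul, h1, one_mul]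
    exact_mod_cast this
  obtain ⟨g⟩ := Function.Embedding.nonempty_of_card_le hcard
  refine ⟨Function.extend g Sigma.fst fun _ => Classical.arbitrary ι, fun f => ?_⟩
  calc N * (∑ j, w j * f j) - ∑ j, (f j : ℝ) = ∑ j, (w j * N - 1) * f j := by
        rw [Finset.mul_sum, ← Finset.sum_sub_distrib]
        exact Finset.sum_congr rfl fun j _ => by ring
    _ ≤ ∑ j, (⌊w j * N⌋₊ : ℝ) * f j := by
        refine Finset.sum_le_sum fun j _ => ?_
        have := Nat.lt_floor_add_one (w j * N)
        gcongr
        linarith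
    _ = ∑ x : Σ j, Fin ⌊w j * N⌋₊, (f x.1 : ℝ) := by
        rw [Fintype.sum_sigma]
        simp
    _ = ∑ x : Σ j, Fin ⌊w j * N⌋₊,
          (f (Function.extend g Sigma.fst (fun _ => Classical.arbitrary ι) (g x)) : ℝ) := by
        simp only [g.injective.extend_apply]
    _ ≤ ∑ t, (f (Function.extend g Sigma.fst (fun _ => Classical.arbitrary ι) t) : ℝ) := by
        rw [← Finset.sum_map Finset.univ g fun t =>
          (f (Function.extend g Sigma.fst (fun _ => Classical.arbitrary ι) t) : ℝ)]
        exact Finset.sum_le_sum_of_subset_of_nonneg (Finset.subset_univ _)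
          fun _ _ _ => Nat.cast_nonneg _

/-- The single-letter factor of the random coding bound for an erasure channel over a large
field. -/
theorem erasure_factor_le {q n k : ℕ} (hq : 1 ≤ q) {p ρ ε : ℝ} (hp0 : 0 ≤ p)
    (hp : p ≤ n / q) (hρ : 0 ≤ ρ) (hkρ : k * ρ ≤ 1) (hε : 0 ≤ ε)
    (hlarge : (n + 1 : ℝ) ≤ (q : ℝ) ^ (ρ * ε)) {Q : ℕ} (hQ : Q = q ^ k) :
    p + (1 - p) * ((Q : ℝ)⁻¹) ^ ρ ≤ (q : ℝ) ^ (-(ρ * (1 - ε)) * k) := by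
  have hq1 : (1 : ℝ) ≤ q := by exact_mod_cast hq
  have hq0 : (0 : ℝ) < q := by linarith
  have e1 : ((Q : ℝ)⁻¹) ^ ρ = (q : ℝ) ^ (-(k * ρ)) := by
    rw [hQ, Nat.cast_pow, Real.inv_rpow (by positivity), ← Real.rpow_natCast, ← Real.rpow_mul hq0.le,
      Real.rpow_neg hq0.le]
  rw [e1]
  rcases Nat.eq_zero_or_pos k with rfl | hk
  · simp
  have hk' : (1 : ℝ) ≤ k := by exact_mod_cast hk
  -- Because k ρ ≤ 1, the erasure probability n / q is no larger than n q ^ (-k ρ), so erasures cost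
  -- only a constant factor.
  have e2 : p ≤ n * (q : ℝ) ^ (-(k * ρ)) := by
    refine hp.trans ?_
    rw [div_eq_mul_inv, ← Real.rpow_neg_one]
    gcongr
  have e3 : (1 - p) * (q : ℝ) ^ (-(k * ρ)) ≤ (q : ℝ) ^ (-(k * ρ)) :=
    mul_le_of_le_one_left (by positivity) (by linarith)
  have e4 : (n + 1 : ℝ) ≤ (q : ℝ) ^ (k * (ρ * ε)) := by
    refine hlarge.trans (Real.rpow_le_rpow_of_exponent_le hq1 ?_)
    exact le_mul_of_one_le_left (by positivity) hk'
  calc p + (1 - p) * (q : ℝ) ^ (-(k * ρ)) ≤ (n + 1) * (q : ℝ) ^ (-(k * ρ)) := by linarith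
    _ ≤ (q : ℝ) ^ (k * (ρ * ε)) * (q : ℝ) ^ (-(k * ρ)) := by gcongr
    _ = (q : ℝ) ^ (-(ρ * (1 - ε)) * k) := by
        rw [← Real.rpow_add hq0]
        congr 1
        ring

/-- The random coding bound vanishes below capacity. -/
theorem tendsto_coding_bound {q : ℕ} (hq : 2 ≤ q) {ρ ε κ c R : ℝ} (hρ : 0 < ρ) (hε : 0 < ε)
    (hε1 : ε < 1) (hκ : 0 ≤ κ) (hR : 0 ≤ R) (hRκ : R ≤ (1 - ε) * (κ * Real.logb 2 q)) :
    Tendsto (fun N : ℕ => ((⌈(2 : ℝ) ^ (N * R)⌉₊ : ℝ) - 1) ^ ρ *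
      (q : ℝ) ^ (-(ρ * (1 - ε / 2)) * (N * κ - c))) atTop (𝓝 0) := by
  have hq1 : (1 : ℝ) < q := by exact_mod_cast hq
  have hq0 : (0 : ℝ) < q := by linarith
  have hL : 0 < Real.logb 2 (q : ℝ) := Real.logb_pos (by norm_num) hq1
  -- At zero capacity there is a single message, and M - 1 = 0 kills the bound.
  rcases hκ.eq_or_lt with rfl | hκ
  · have : R = 0 := by
      rw [zero_mul, mul_zero] at hRκ
      exact le_antisymm hRκ hR
    simp [this, Real.zero_rpow hρ.ne']
  set L := Real.logb 2 (q : ℝ) with hLdef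
  have hqL : ∀ x : ℝ, (q : ℝ) ^ x = 2 ^ (L * x) := fun x => by
    rw [Real.rpow_mul (by norm_num), hLdef, Real.rpow_logb (by norm_num) (by norm_num) hq0]
  have hr : (2 : ℝ) ^ (-(ρ * (ε / 2) * κ * L)) < 1 :=
    Real.rpow_lt_one_of_one_lt_of_neg (by norm_num) (by
      have : 0 < ρ * (ε / 2) * κ * L := by positivity
      linarith)
  have hlim := (tendsto_pow_atTop_nhds_zero_of_lt_one (by positivity) hr).const_mul
    ((2 : ℝ) ^ (L * (ρ * (1 - ε / 2) * c)))
  rw [mul_zero] at hlim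
  refine squeeze_zero (fun N => ?_) (fun N => ?_) hlim
  · refine mul_nonneg (Real.rpow_nonneg ?_ _) (by positivity)
    have : (1 : ℝ) ≤ ⌈(2 : ℝ) ^ (N * R)⌉₊ := by
      exact_mod_cast Nat.ceil_pos.2 (by positivity : (0 : ℝ) < 2 ^ (N * R))
    linarith
  · have hc := Nat.ceil_lt_add_one (by positivity : (0 : ℝ) ≤ 2 ^ (N * R))
    have h1 : (1 : ℝ) ≤ ⌈(2 : ℝ) ^ (N * R)⌉₊ := by
      exact_mod_cast Nat.ceil_pos.2 (by positivity : (0 : ℝ) < 2 ^ (N * R))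
    calc ((⌈(2 : ℝ) ^ (N * R)⌉₊ : ℝ) - 1) ^ ρ * (q : ℝ) ^ (-(ρ * (1 - ε / 2)) * (N * κ - c))
        ≤ ((2 : ℝ) ^ (N * R)) ^ ρ * (q : ℝ) ^ (-(ρ * (1 - ε / 2)) * (N * κ - c)) := by
          gcongr
          linarith
      _ = (2 : ℝ) ^ (N * R * ρ + L * (-(ρ * (1 - ε / 2)) * (N * κ - c))) := by
          rw [hqL, ← Real.rpow_mul (by norm_num), ← Real.rpow_add (by norm_num)]
      _ ≤ (2 : ℝ) ^ (L * (ρ * (1 - ε / 2) * c) + -(ρ * (ε / 2) * κ * L) * N) := by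
          refine Real.rpow_le_rpow_of_exponent_le (by norm_num) ?_
          -- The rate uses the fraction 1 - ε and the exponent provides 1 - ε / 2; the gap ε / 2
          -- gives exponential decay.
          have : N * ρ * R ≤ N * ρ * ((1 - ε) * (κ * L)) := by gcongr
          linarith
      _ = (2 : ℝ) ^ (L * (ρ * (1 - ε / 2) * c)) * ((2 : ℝ) ^ (-(ρ * (ε / 2) * κ * L))) ^ N := by
          rw [Real.rpow_add (by norm_num), Real.rpow_mul (by norm_num) _ (N : ℝ), Real.rpow_natCast]

variable {F : Type*} [Field F] [Fintype F] [DecidableEq F] {n m₁ m₂ T : ℕ}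

omit [DecidableEq F] in
/-- The random coding bound for one user of the erasure scheme. -/
theorem exists_user_code {N M : ℕ} (hM : 0 < M) (r c : Fin N → ℕ) {p : Fin N → ℝ}
    (hp0 : ∀ t, 0 ≤ p t) (hp1 : ∀ t, p t ≤ 1) (hp : ∀ t, p t ≤ n / Fintype.card F) {ρ ε K : ℝ}
    (hρ : 0 ≤ ρ) (hρ1 : ρ ≤ 1) (hk : ∀ t, (r t * c t : ℕ) * ρ ≤ 1) (hε : 0 ≤ ε) (hε1 : ε ≤ 1)
    (hlarge : (n + 1 : ℝ) ≤ (Fintype.card F : ℝ) ^ (ρ * ε))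
    (hK : K ≤ ∑ t, ((r t * c t : ℕ) : ℝ)) :
    ∃ enc : Fin M → ∀ t, Fin (r t) → Fin (c t) → F, erasureError p enc
      ≤ ((M : ℝ) - 1) ^ ρ * (Fintype.card F : ℝ) ^ (-(ρ * (1 - ε)) * K) := by
  have hq : 1 ≤ Fintype.card F := Fintype.card_pos
  have hq1 : (1 : ℝ) ≤ Fintype.card F := by exact_mod_cast hq
  have hM1 : (0 : ℝ) ≤ (M : ℝ) - 1 := by
    have : (1 : ℝ) ≤ M := by exact_mod_cast hM
    linarith
  obtain ⟨enc, henc⟩ := exists_erasureError_le hM (fun t => Fin (r t) → Fin (c t) → F) hp0 hp1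
    hρ hρ1
  refine ⟨enc, henc.trans (mul_le_mul_of_nonneg_left ?_ (by positivity))⟩
  calc ∏ t, (p t + (1 - p t) * ((Fintype.card (Fin (r t) → Fin (c t) → F) : ℝ)⁻¹) ^ ρ)
      ≤ ∏ t, (Fintype.card F : ℝ) ^ (-(ρ * (1 - ε)) * ((r t * c t : ℕ) : ℝ)) := by
        refine Finset.prod_le_prod (fun t _ => ?_) fun t _ => ?_
        · have := hp1 t
          exact add_nonneg (hp0 t) (mul_nonneg (by linarith) (by positivity))
        · refine erasure_factor_le hq (hp0 t) (hp t) hρ (hk t) hε hlarge ?_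
          simp [← pow_mul, mul_comm]
    _ = (Fintype.card F : ℝ) ^ (-(ρ * (1 - ε)) * ∑ t, ((r t * c t : ℕ) : ℝ)) := by
        rw [Finset.mul_sum, Real.rpow_sum_of_pos (by linarith)]
    _ ≤ (Fintype.card F : ℝ) ^ (-(ρ * (1 - ε)) * K) := by
        refine Real.rpow_le_rpow_of_exponent_le hq1 ?_
        have : ρ * (1 - ε) * K ≤ ρ * (1 - ε) * ∑ t, ((r t * c t : ℕ) : ℝ) :=
          mul_le_mul_of_nonneg_left hK (mul_nonneg hρ (by linarith))
        linarith

/-- The inner bound on the capacity region. -/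
theorem subset_capacityRegion (hT : m₁ + m₂ ≤ T) {ε : ℝ} (hε : 0 < ε) (hε1 : ε < 1)
    (hlarge : (n + 1 : ℝ) ≤ (Fintype.card F : ℝ) ^ (1 / (n * T + 1 : ℝ) * (ε / 2))) :
    (1 - ε) • asymptoticRegion (Fintype.card F) n m₁ m₂ T
      ⊆ capacityRegion (matrixMAC F n m₁ m₂ T) := by
  rintro _ ⟨x, hx, rfl⟩
  refine subset_closure ?_
  rw [asymptoticRegion, mem_convexHull_iff_exists_fintype] at hx
  obtain ⟨ι, _, w, z, hw0, hw1, hz, hzx⟩ := hx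
  simp only [Set.mem_iUnion] at hz
  choose d hd hz using hz
  have hq : 2 ≤ Fintype.card F := Fintype.one_lt_card
  set q := Fintype.card F
  set L := Real.logb 2 (q : ℝ) with hL
  have hdT : ∀ j, (d j).1 + (d j).2 ≤ T := fun j => le_total_of_mem_dimPairs hT (hd j)
  have hd₁ : ∀ j, (d j).1 ≤ m₁ := fun j => (hd j).1.trans (min_le_right _ _)
  have hd₂ : ∀ j, (d j).2 ≤ m₂ := fun j => (hd j).2.1.trans (min_le_right _ _)
  have hdn : ∀ j, (d j).1 + (d j).2 ≤ n := fun j => (hd j).2.2.trans (min_le_left _ _)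
  let e : ι → ℕ := fun j => T - (d j).1 - (d j).2
  have he : ∀ j, (T : ℝ) - (d j).1 - (d j).2 = e j := fun j => by
    have := hdT j
    simp only [e]
    rw [Nat.cast_sub (by omega), Nat.cast_sub (by omega)]
  set κ₁ : ℝ := ∑ j, w j * ((d j).1 * e j : ℕ)
  set κ₂ : ℝ := ∑ j, w j * ((d j).2 * e j : ℕ)
  have hx1 : x.1 = ∑ j, w j * (z j).1 := by simp [← hzx, Prod.fst_sum]
  have hx2 : x.2 = ∑ j, w j * (z j).2 := by simp [← hzx, Prod.snd_sum]
  have hx1' : x.1 ≤ κ₁ * L := by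
    rw [hx1, Finset.sum_mul]
    refine Finset.sum_le_sum fun j _ => ?_
    rw [mul_assoc]
    refine mul_le_mul_of_nonneg_left ((hz j).1.2.trans_eq ?_) (hw0 j)
    rw [he j]
    push_cast
    rfl
  have hx2' : x.2 ≤ κ₂ * L := by
    rw [hx2, Finset.sum_mul]
    refine Finset.sum_le_sum fun j _ => ?_
    rw [mul_assoc]
    refine mul_le_mul_of_nonneg_left ((hz j).2.2.trans_eq ?_) (hw0 j)
    rw [he j]
    push_cast
    rfl
  have hx1n : 0 ≤ x.1 := hx1 ▸ Finset.sum_nonneg fun j _ => mul_nonneg (hw0 j) (hz j).1.1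
  have hx2n : 0 ≤ x.2 := hx2 ▸ Finset.sum_nonneg fun j _ => mul_nonneg (hw0 j) (hz j).2.1
  have hκ₁ : 0 ≤ κ₁ := Finset.sum_nonneg fun j _ => mul_nonneg (hw0 j) (Nat.cast_nonneg _)
  have hκ₂ : 0 ≤ κ₂ := Finset.sum_nonneg fun j _ => mul_nonneg (hw0 j) (Nat.cast_nonneg _)
  have hε' : 0 ≤ 1 - ε := by linarith
  -- This ρ satisfies k ρ ≤ 1 for every mode, as k = dᵢ (T - d₁ - d₂) ≤ n T; the added 1 avoids
  -- division by zero.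
  set ρ : ℝ := 1 / (n * T + 1 : ℝ)
  have hnT : (0 : ℝ) ≤ n * T := by positivity
  have hρ : 0 < ρ := by positivity
  have hρ1 : ρ ≤ 1 := by
    rw [div_le_one (by linarith)]
    linarith
  have hkρ : ∀ a b : ℕ, a ≤ n → b ≤ T → (a * b : ℕ) * ρ ≤ 1 := by
    intro a b ha hb
    have : ((a * b : ℕ) : ℝ) ≤ n * T := by exact_mod_cast Nat.mul_le_mul ha hb
    rw [mul_one_div, div_le_one (by linarith)]
    linarith
  set c₁ : ℝ := ∑ j, (((d j).1 * e j : ℕ) : ℝ)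
  set c₂ : ℝ := ∑ j, (((d j).2 * e j : ℕ) : ℝ)
  have hR1 : 0 ≤ ((1 - ε) • x).1 := mul_nonneg hε' hx1n
  have hR2 : 0 ≤ ((1 - ε) • x).2 := mul_nonneg hε' hx2n
  have t1 := tendsto_coding_bound (c := c₁) hq hρ hε hε1 hκ₁ hR1
    (mul_le_mul_of_nonneg_left hx1' hε')
  have t2 := tendsto_coding_bound (c := c₂) hq hρ hε hε1 hκ₂ hR2
    (mul_le_mul_of_nonneg_left hx2' hε')
  have t := t1.add t2
  rw [add_zero] at t
  choose φ₁ φ₂ bad p hp0 hp1 hpn hpsum hinj using fun j =>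
    exists_erasure_scheme (F := F) (hd₁ j) (hd₂ j) (hdn j) (hdT j)
  refine ⟨hR1, hR2, fun δ hδ => ?_⟩
  obtain ⟨N₀, hN₀⟩ := eventually_atTop.1 (t.eventually (gt_mem_nhds hδ))
  refine ⟨N₀, fun N hN => ?_⟩
  have hlt := hN₀ N hN
  set M₁ := ⌈(2 : ℝ) ^ (N * ((1 - ε) • x).1)⌉₊
  set M₂ := ⌈(2 : ℝ) ^ (N * ((1 - ε) • x).2)⌉₊
  have hM₁ : 0 < M₁ := Nat.ceil_pos.2 (by positivity)
  have hM₂ : 0 < M₂ := Nat.ceil_pos.2 (by positivity)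
  obtain ⟨τ, hτ⟩ := exists_assignment hw0 hw1 N
  obtain ⟨enc₁, henc₁⟩ := exists_user_code (F := F) (n := n) hM₁ (fun t => (d (τ t)).1)
    (fun t => e (τ t)) (fun t => hp0 (τ t)) (fun t => hp1 (τ t)) (fun t => hpn (τ t)) hρ.le hρ1
    (fun t => hkρ _ _ (by have := hdn (τ t); omega) (by simp only [e]; omega))
    (by linarith : 0 ≤ ε / 2) (by linarith) hlarge (hτ fun j => (d j).1 * e j)
  obtain ⟨enc₂, henc₂⟩ := exists_user_code (F := F) (n := n) hM₂ (fun t => (d (τ t)).2)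
    (fun t => e (τ t)) (fun t => hp0 (τ t)) (fun t => hp1 (τ t)) (fun t => hpn (τ t)) hρ.le hρ1
    (fun t => hkρ _ _ (by have := hdn (τ t); omega) (by simp only [e]; omega))
    (by linarith : 0 ≤ ε / 2) (by linarith) hlarge (hτ fun j => (d j).2 * e j)
  obtain ⟨c, hc⟩ := exists_code_errorProb_le (matrixMAC F n m₁ m₂ T) hM₁ hM₂
    (fun t => φ₁ (τ t)) (fun t => φ₂ (τ t)) (fun t => bad (τ t)) (fun t => hpsum (τ t))
    (fun t => hinj (τ t)) enc₁ enc₂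
  exact ⟨M₁, M₂, c, Nat.le_ceil _, Nat.le_ceil _, hc.trans ((add_le_add henc₁ henc₂).trans hlt.le)⟩

end InnerBound

/-! ### The main theorem: both bounds for large fields -/

theorem mainTheorem6 (n m₁ m₂ T : ℕ) (hT : (m₁ : ℝ) + m₂ < (T : ℝ) / 2)
    (ε : ℝ) (hε : 0 < ε) (hε1 : ε < 1) :
    ∃ q₀ : ℕ, ∀ (F : Type*) [Field F] [Fintype F] [DecidableEq F], q₀ ≤ Fintype.card F →
      (1 - ε) • asymptoticRegion (Fintype.card F) n m₁ m₂ T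
          ⊆ capacityRegion (matrixMAC F n m₁ m₂ T) ∧
      capacityRegion (matrixMAC F n m₁ m₂ T)
          ⊆ (1 + ε) • asymptoticRegion (Fintype.card F) n m₁ m₂ T := by
  have hT' : m₁ + m₂ + 1 ≤ T := by
    have h : ((m₁ + m₂ : ℕ) : ℝ) < T := by
      have : (0 : ℝ) ≤ T := Nat.cast_nonneg T
      push_cast
      linarith
    exact_mod_cast h
  -- Large q makes log q exceed the overhead of the outer bound and a fixed positive power of q
  -- exceed n + 1 for the inner bound.
  have hlog := ((Real.tendsto_logb_atTop (b := 2) (by norm_num)).comp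
    tendsto_natCast_atTop_atTop).eventually_ge_atTop (2 * n * (m₁ + m₂) / ε : ℝ)
  have hpow := ((tendsto_rpow_atTop (y := 1 / (n * T + 1 : ℝ) * (ε / 2)) (by positivity)).comp
    tendsto_natCast_atTop_atTop).eventually_ge_atTop (n + 1 : ℝ)
  obtain ⟨q₀, hq₀⟩ := eventually_atTop.1 (hlog.and hpow)
  refine ⟨q₀, fun F _ _ _ hF => ?_⟩
  obtain ⟨h1, h2⟩ := hq₀ _ hF
  exact ⟨subset_capacityRegion (by omega) hε hε1 h2, capacityRegion_subset hT' hε h1⟩
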